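/- Let $\mathbb R^3_1$ be $\mathbb R^3$ with the scalar product $\langle a,b\rangle=-a_1b_1+a_2b_2+a_3b_3$; a motion is a map $y\mapsto Ay+b$ with $A$ linear and $\langle Ay,Az\rangle=\langle y,z\rangle$ for all $y,z$ (proper if $\det A=1$, improper if $\det A=-1$). For a smooth map $x=x(u,v)$ from an open set $D\subset\mathbb R^2$ to $\mathbb R^3_1$, let $E,F,G$ be the coefficients of the first fundamental form, let $L,M,N$ be those of the second fundamental form with respect to the unit normal $l$ for which $(x_u,x_v,l)$ is positively oriented, and let $$K=\frac{LN-M^2}{EG-F^2},\qquad H=\frac{EN-2FM+GL}{2(EG-F^2)}.$$ The map $x$ is a Lorentz surface if $EG-F^2<0$ on $D$. It is minimal if $H\equiv0$, and of general type if $H^2-K\neq0$ everywhere. The parameters $(u,v)$ are canonical isotropic coordinates with initial point $x(u_0,v_0)$, where $(u_0,v_0)\in D$, if $E=G=0$ and $F>0$ on $D$ and there are constants $\varepsilon_1,\varepsilon_2\in\{1,-1\}$ with $L(u,v_0)=\varepsilon_1$ whenever $(u,v_0)\in D$ and $N(u_0,v)=\varepsilon_2$ whenever $(u_0,v)\in D$.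 The domain $D$ of a surface in canonical coordinates is always assumed to contain, with each point $(u,v)$, the segments joining $(u,v)$ to $(u,v_0)$ and to $(u_0,v)$ (for instance, $D$ is an open rectangle with sides parallel to the axes). (1) Let $x:D\to\mathbb R^3_1$ be a minimal Lorentz surface of general type in canonical isotropic coordinates. Then its Gauss curvature $K$ is a smooth solution on $D$ of the natural equation $$\sqrt{|K|}\,\bigl(\ln\sqrt{|K|}\bigr)_{uv}=K,\qquad K\neq0.$$ If $g$ is any motion of $\mathbb R^3_1$, proper or improper, then $g\circ x$ is again a minimal Lorentz surface of general type in canonical isotropic coordinates (with initial point $g(x(u_0,v_0))$), and it has the same Gauss curvature $K$ on $D$. (2) Conversely, let $K$ be a smooth solution of the natural equation on an open set $D\subset\mathbb R^2$. Then every point $(u_0,v_0)\in D$ has an open neighbourhood $U\subset D$ on which there is a minimal Lorentz surface $x:U\to\mathbb R^3_1$ of general type, in canonical isotropic coordinates $(u,v)$ with initial point $x(u_0,v_0)$, whose Gauss curvature is the given function $K$. This surface is unique up to a motion: if $x_1,x_2:U\to\mathbb R^3_1$, $U\subset D$, are two minimal Lorentz surfaces of general type in canonical isotropic coordinates (with initial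 points $x_1(u_1,v_1)$ and $x_2(u_2,v_2)$ that may correspond to different parameter values) whose Gauss curvature is $K$, then $x_2=g\circ x_1$ on $U$ for some motion $g$, proper or improper. -/

import Mathlib

open scoped ContDiff

noncomputable section

namespace LorentzSurf

/-- The underlying vector space of the pseudo-Euclidean space `ℝ³₁`. -/
abbrev R31 : Type := Fin 3 → ℝ

/-- The indefinite scalar product `⟨a, b⟩ = -a₁b₁ + a₂b₂ + a₃b₃`. -/
def mink (a b : R31) : ℝ := -(a 0 * b 0) + a 1 * b 1 + a 2 * b 2

/-- The vector product of `ℝ³₁`, characterised by `⟨a × b, c⟩ = det (a, b, c)`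
(see `mink_cross`). -/
def cross (a b : R31) : R31 :=
  ![-(a 1 * b 2 - a 2 * b 1), a 2 * b 0 - a 0 * b 2, a 0 * b 1 - a 1 * b 0]

theorem mink_cross (a b c : R31) : mink (cross a b) c = Matrix.det (Matrix.of ![a, b, c]) := by
  simp [mink, cross, Matrix.det_fin_three]
  ring

/-- The length `|w| = √|⟨w, w⟩|`. -/
def len (w : R31) : ℝ := Real.sqrt |mink w w|

/-- A motion (proper or improper) of `ℝ³₁`: an affine map whose linear part preserves the
scalar product. -/
def IsMotion (g : R31 → R31) : Prop :=
  ∃ (A : R31 →ₗ[ℝ] R31) (b : R31),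
    (∀ y z, mink (A y) (A z) = mink y z) ∧ ∀ y, g y = A y + b

/-- Partial derivative with respect to the first variable `u`. -/
def du {V : Type*} [NormedAddCommGroup V] [NormedSpace ℝ V] (f : ℝ × ℝ → V) (p : ℝ × ℝ) : V :=
  fderiv ℝ f p (1, 0)

/-- Partial derivative with respect to the second variable `v`. -/
def dv {V : Type*} [NormedAddCommGroup V] [NormedSpace ℝ V] (f : ℝ × ℝ → V) (p : ℝ × ℝ) : V :=
  fderiv ℝ f p (0, 1)

/-! Coefficients of the first fundamental form of `x`. -/

def coefE (x : ℝ × ℝ → R31) (p : ℝ × ℝ) : ℝ := mink (du x p) (du x p)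
def coefF (x : ℝ × ℝ → R31) (p : ℝ × ℝ) : ℝ := mink (du x p) (dv x p)
def coefG (x : ℝ × ℝ → R31) (p : ℝ × ℝ) : ℝ := mink (dv x p) (dv x p)

/-- The unit normal `l = (x_u × x_v) / |x_u × x_v|`; for a Lorentz surface `(x_u, x_v, l)` is
positively oriented and `⟨l, l⟩ = 1`. -/
def unitNormal (x : ℝ × ℝ → R31) (p : ℝ × ℝ) : R31 :=
  (len (cross (du x p) (dv x p)))⁻¹ • cross (du x p) (dv x p)

/-! Coefficients of the second fundamental form of `x`. -/

def coefL (x : ℝ × ℝ → R31) (p : ℝ × ℝ) : ℝ := mink (du (du x) p) (unitNormal x p)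
def coefM (x : ℝ × ℝ → R31) (p : ℝ × ℝ) : ℝ := mink (dv (du x) p) (unitNormal x p)
def coefN (x : ℝ × ℝ → R31) (p : ℝ × ℝ) : ℝ := mink (dv (dv x) p) (unitNormal x p)

/-- The Gauss curvature. -/
def gaussK (x : ℝ × ℝ → R31) (p : ℝ × ℝ) : ℝ :=
  (coefL x p * coefN x p - coefM x p ^ 2) / (coefE x p * coefG x p - coefF x p ^ 2)

/-- The mean curvature. -/
def meanH (x : ℝ × ℝ → R31) (p : ℝ × ℝ) : ℝ :=
  (coefE x p * coefN x p - 2 * coefF x p * coefM x p + coefG x p * coefL x p) /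
    (2 * (coefE x p * coefG x p - coefF x p ^ 2))

/-- `x`, restricted to the open set `D`, is a (smooth, parametrised) Lorentz surface: the induced
metric has signature `(1, 1)`. This makes `x_u, x_v` linearly independent, so that `x` is an
immersion on `D`. -/
structure IsLorentzSurface (D : Set (ℝ × ℝ)) (x : ℝ × ℝ → R31) : Prop where
  isOpen : IsOpen D
  smooth : ContDiffOn ℝ ∞ x D
  lorentz : ∀ p ∈ D, coefE x p * coefG x p - coefF x p ^ 2 < 0

/-- The surface is of general type: `H² - K ≠ 0`. -/
def IsGeneralType (D : Set (ℝ × ℝ)) (x : ℝ × ℝ → R31) : Prop :=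
  ∀ p ∈ D, meanH x p ^ 2 - gaussK x p ≠ 0

/-- The surface is minimal: `H = 0`. -/
def IsMinimal (D : Set (ℝ × ℝ)) (x : ℝ × ℝ → R31) : Prop :=
  ∀ p ∈ D, meanH x p = 0

/-- The parameters `(u, v)` are isotropic, normalised by `F > 0`. -/
def IsIsotropic (D : Set (ℝ × ℝ)) (x : ℝ × ℝ → R31) : Prop :=
  ∀ p ∈ D, coefE x p = 0 ∧ coefG x p = 0 ∧ 0 < coefF x p

/-- The isotropic parameters `(u, v)` are canonical with initial point `x (u₀, v₀)`,
`p₀ = (u₀, v₀)`: `L(u, v₀) = ε₁` and `N(u₀, v) = ε₂` with constants `ε₁, ε₂ = ±1`. -/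
def IsCanonical (D : Set (ℝ × ℝ)) (p₀ : ℝ × ℝ) (x : ℝ × ℝ → R31) : Prop :=
  IsIsotropic D x ∧ p₀ ∈ D ∧
    ∃ ε₁ ε₂ : ℝ, (ε₁ = 1 ∨ ε₁ = -1) ∧ (ε₂ = 1 ∨ ε₂ = -1) ∧
      (∀ u : ℝ, (u, p₀.2) ∈ D → coefL x (u, p₀.2) = ε₁) ∧
      (∀ v : ℝ, (p₀.1, v) ∈ D → coefN x (p₀.1, v) = ε₂)

/-- `D` is an open neighbourhood of `p₀ = (u₀, v₀)` which contains with each of its points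
`(u, v)` the coordinate segments from `(u, v)` to `(u, v₀)` and to `(u₀, v)`. Every open
coordinate rectangle containing `p₀` is of this kind. -/
structure IsCoordDomain (D : Set (ℝ × ℝ)) (p₀ : ℝ × ℝ) : Prop where
  isOpen : IsOpen D
  mem : p₀ ∈ D
  vert : ∀ u v : ℝ, (u, v) ∈ D → ∀ s ∈ Set.uIcc p₀.2 v, (u, s) ∈ D
  horiz : ∀ u v : ℝ, (u, v) ∈ D → ∀ s ∈ Set.uIcc p₀.1 u, (s, v) ∈ D

/-- A minimal Lorentz surface of general type, parametrised on `D` by canonical isotropic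
coordinates with initial point `x p₀`. -/
structure IsCanonicalMinimal (D : Set (ℝ × ℝ)) (p₀ : ℝ × ℝ) (x : ℝ × ℝ → R31) : Prop where
  domain : IsCoordDomain D p₀
  lorentz : IsLorentzSurface D x
  general : IsGeneralType D x
  minimal : IsMinimal D x
  canonical : IsCanonical D p₀ x

/-- `K` is a (smooth) solution on `D` of the natural equation
`√|K| (ln √|K|)_{uv} = K`, `K ≠ 0`. -/
structure SolvesNatural (D : Set (ℝ × ℝ)) (K : ℝ × ℝ → ℝ) : Prop where
  smooth : ContDiffOn ℝ ∞ K D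
  ne_zero : ∀ p ∈ D, K p ≠ 0
  eqn : ∀ p ∈ D,
    Real.sqrt |K p| * dv (du (fun q => Real.log (Real.sqrt |K q|))) p = K p

end LorentzSurf

end

noncomputable section

namespace LorentzSurf

open Set Filter Topology

/-! ### Algebra of the scalar product -/

/-! In isotropic coordinates E = G = 0, so H = M/F and minimality means M = 0. Then x_uv has no
component along x_u, x_v or l, hence x_uv = 0 (`dv_du`). The Codazzi equations become L_v = N_u = 0,
so the canonical normalisation spreads from the two coordinate lines to all of D: L and N are
constant signs. Therefore K = -LN/F² and √|K| = 1/F, and the Gauss equation (ln F)_uv = LN/F is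
exactly the natural equation (`solvesNatural`). A motion multiplies L, M, N by its determinant ±1
and fixes E, F, G, hence preserves K.

Uniqueness: K determines F and the product LN, so the pairs (L, N) of two surfaces agree up to a
common sign, and composing with -id removes the sign. The frames (x_u, x_v, l) then solve the same
linear Gauss-Weingarten system and have the same Gram matrix, so the map between them is a constant
isometry (`frameMap_const`, `exists_motion_of_coef_eq`).

Existence: with F = 2τ² the natural equation becomes the Liouville equation τ τ_uv - τ_u τ_v = ε/4,
where ε = LN. Its solutions separate as τ = y₁(u) z₂(v) - y₂(u) z₁(v) with constant Wronskians
(`exists_separation`). Reading y and z as spinors, whose squares are isotropic vectors, and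
integrating these squares gives a translation surface with the required F, L, N
(`exists_canonicalMinimal_of_spinors`). -/

theorem mink_comm (a b : R31) : mink a b = mink b a := by
  simp only [mink]; ring

theorem mink_add_left (a b c : R31) : mink (a + b) c = mink a c + mink b c := by
  simp only [mink, Pi.add_apply]; ring

theorem mink_add_right (a b c : R31) : mink a (b + c) = mink a b + mink a c := by
  simp only [mink, Pi.add_apply]; ring

theorem mink_smul_left (r : ℝ) (a b : R31) : mink (r • a) b = r * mink a b := by
  simp only [mink, Pi.smul_apply, smul_eq_mul]; ring

theorem mink_smul_right (r : ℝ) (a b : R31) : mink a (r • b) = r * mink a b := by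
  simp only [mink, Pi.smul_apply, smul_eq_mul]; ring

theorem mink_zero_left (a : R31) : mink 0 a = 0 := by simp [mink]

theorem mink_zero_right (a : R31) : mink a 0 = 0 := by simp [mink]

theorem mink_cross_left (a b : R31) : mink (cross a b) a = 0 := by
  simp [mink, cross]; ring

theorem mink_cross_right (a b : R31) : mink (cross a b) b = 0 := by
  simp [mink, cross]; ring

theorem mink_cross_self (a b : R31) :
    mink (cross a b) (cross a b) = mink a b ^ 2 - mink a a * mink b b := by
  simp [mink, cross]; ring

/-- Cramer's rule in the basis a, b, a × b with the Gram factor ⟨a × b, a × b⟩ cleared from the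
denominators, which makes it a polynomial identity free of nondegeneracy assumptions. -/
theorem cross_expansion (a b w : R31) :
    (mink a b ^ 2 - mink a a * mink b b) • w =
      (mink a b * mink w b - mink b b * mink w a) • a +
      (mink a b * mink w a - mink a a * mink w b) • b +
      mink w (cross a b) • cross a b := by
  ext i
  fin_cases i <;> simp [mink, cross] <;> ring

/-- `mink` as a continuous bilinear map. -/
def minkL : R31 →L[ℝ] R31 →L[ℝ] ℝ :=
  LinearMap.toContinuousLinearMap
    { toFun := fun a => LinearMap.toContinuousLinearMap
        { toFun := fun b => mink a b
          map_add' := mink_add_right a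
          map_smul' := fun r b => mink_smul_right r a b }
      map_add' := fun a b => by ext1 c; exact mink_add_left a b c
      map_smul' := fun r a => by ext1 c; exact mink_smul_left r a c }

theorem minkL_apply (a b : R31) : minkL a b = mink a b := rfl

/-! ### Directional derivatives -/

section Directional

variable {V : Type*} [NormedAddCommGroup V] [NormedSpace ℝ V]

/-- The derivative of `f` in the direction `e`. -/
def pd (e : ℝ × ℝ) (f : ℝ × ℝ → V) (p : ℝ × ℝ) : V := fderiv ℝ f p e

theorem du_eq_pd (f : ℝ × ℝ → V) : du f = pd (1, 0) f := rfl

theorem dv_eq_pd (f : ℝ × ℝ → V) : dv f = pd (0, 1) f := rfl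

variable {D : Set (ℝ × ℝ)} {p : ℝ × ℝ} {f g : ℝ × ℝ → V} (e : ℝ × ℝ)

theorem _root_.ContDiffOn.differentiableAt_of_isOpen (hf : ContDiffOn ℝ ∞ f D) (hD : IsOpen D)
    (hp : p ∈ D) : DifferentiableAt ℝ f p :=
  (hf.contDiffAt (hD.mem_nhds hp)).differentiableAt (by simp)

theorem contDiffOn_pd (hD : IsOpen D) (hf : ContDiffOn ℝ ∞ f D) :
    ContDiffOn ℝ ∞ (pd e f) D := by
  have := hf.fderiv_of_isOpen (m := ∞) hD (by simp)
  exact this.clm_apply contDiffOn_const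

theorem pd_congr (hD : IsOpen D) (hp : p ∈ D) (h : ∀ q ∈ D, f q = g q) :
    pd e f p = pd e g p := by
  have : f =ᶠ[𝓝 p] g := by filter_upwards [hD.mem_nhds hp] with q hq using h q hq
  simp only [pd, this.fderiv_eq]

theorem pd_const (c : V) : pd e (fun _ => c) p = 0 := by
  simp [pd]

theorem pd_eq_zero_of_eq_const (hD : IsOpen D) (hp : p ∈ D) {c : V} (h : ∀ q ∈ D, f q = c) :
    pd e f p = 0 := by
  rw [pd_congr e hD hp h, pd_const]

theorem pd_add (hf : DifferentiableAt ℝ f p) (hg : DifferentiableAt ℝ g p) :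
    pd e (fun q => f q + g q) p = pd e f p + pd e g p := by
  simp [pd, fderiv_fun_add hf hg]

theorem pd_sub (hf : DifferentiableAt ℝ f p) (hg : DifferentiableAt ℝ g p) :
    pd e (fun q => f q - g q) p = pd e f p - pd e g p := by
  simp [pd, fderiv_fun_sub hf hg]

theorem pd_smul {r : ℝ × ℝ → ℝ} (hr : DifferentiableAt ℝ r p) (hf : DifferentiableAt ℝ f p) :
    pd e (fun q => r q • f q) p = r p • pd e f p + pd e r p • f p := by
  simp [pd, fderiv_fun_smul hr hf]

theorem pd_mul {r s : ℝ × ℝ → ℝ} (hr : DifferentiableAt ℝ r p) (hs : DifferentiableAt ℝ s p) :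
    pd e (fun q => r q * s q) p = r p * pd e s p + pd e r p * s p :=
  pd_smul e hr hs

theorem pd_comp {W : Type*} [NormedAddCommGroup W] [NormedSpace ℝ W] (A : V →L[ℝ] W)
    (hf : DifferentiableAt ℝ f p) : pd e (fun q => A (f q)) p = A (pd e f p) := by
  have := (A.hasFDerivAt.comp p hf.hasFDerivAt).fderiv
  simp only [pd]
  erw [this]
  rfl

theorem pd_real_comp {h : ℝ → ℝ} {h' : ℝ} {r : ℝ × ℝ → ℝ} (hh : HasDerivAt h h' (r p))
    (hr : DifferentiableAt ℝ r p) : pd e (fun q => h (r q)) p = h' * pd e r p := by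
  have := (hh.comp_hasFDerivAt p hr.hasFDerivAt).fderiv
  simp only [pd]
  erw [this]
  simp

theorem pd_comm (hD : IsOpen D) (hf : ContDiffOn ℝ ∞ f D) (hp : p ∈ D) (e' : ℝ × ℝ) :
    pd e (pd e' f) p = pd e' (pd e f) p := by
  have hc := hf.contDiffAt (hD.mem_nhds hp)
  have hd : DifferentiableAt ℝ (fderiv ℝ f) p :=
    (hc.fderiv_right (m := 1) (by norm_cast)).differentiableAt (by simp)
  have hs : IsSymmSndFDerivAt ℝ f p :=
    hc.isSymmSndFDerivAt (by simp [minSmoothness_of_isRCLikeNormedField]; norm_cast)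
  have key : ∀ a b : ℝ × ℝ, pd a (pd b f) p = fderiv ℝ (fderiv ℝ f) p a b := by
    intro a b
    have : HasFDerivAt (pd b f) _ p := hd.hasFDerivAt.clm_apply (hasFDerivAt_const b p)
    rw [pd, this.fderiv]
    simp
  rw [key, key]
  exact hs.eq e e'

end Directional

theorem contDiffOn_mink {D : Set (ℝ × ℝ)} {f g : ℝ × ℝ → R31} (hf : ContDiffOn ℝ ∞ f D)
    (hg : ContDiffOn ℝ ∞ g D) : ContDiffOn ℝ ∞ (fun p => mink (f p) (g p)) D :=
  (minkL.contDiff.comp_contDiffOn hf).clm_apply hg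

theorem pd_mink (e : ℝ × ℝ) {f g : ℝ × ℝ → R31} {p : ℝ × ℝ} (hf : DifferentiableAt ℝ f p)
    (hg : DifferentiableAt ℝ g p) :
    pd e (fun q => mink (f q) (g q)) p = mink (pd e f p) (g p) + mink (f p) (pd e g p) := by
  have := ((minkL.hasFDerivAt.comp p hf.hasFDerivAt).clm_apply hg.hasFDerivAt).fderiv
  simp only [pd]
  erw [this]
  simp [minkL_apply, add_comm]

theorem eq_of_pd_eq_zero {V : Type*} [NormedAddCommGroup V] [NormedSpace ℝ V]
    {f : ℝ × ℝ → V} {D : Set (ℝ × ℝ)} (hD : IsOpen D) (hc : IsPreconnected D)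
    (hf : ContDiffOn ℝ ∞ f D) (hu : ∀ p ∈ D, pd (1, 0) f p = 0) (hv : ∀ p ∈ D, pd (0, 1) f p = 0)
    {p q : ℝ × ℝ} (hp : p ∈ D) (hq : q ∈ D) : f p = f q := by
  refine hD.is_const_of_fderiv_eq_zero hc (𝕜 := ℝ) (hf.differentiableOn (by simp)) ?_ hp hq
  intro r hr
  ext1
  · ext1; simpa [pd] using hu r hr
  · ext1; simpa [pd] using hv r hr

/-! ### Functions of one variable on slices -/

theorem hasDerivAt_slice_fst {V : Type*} [NormedAddCommGroup V] [NormedSpace ℝ V]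
    {f : ℝ × ℝ → V} {u v : ℝ} (hf : DifferentiableAt ℝ f (u, v)) :
    HasDerivAt (fun t => f (t, v)) (pd (1, 0) f (u, v)) u :=
  hf.hasFDerivAt.comp_hasDerivAt u ((hasDerivAt_id u).prodMk (hasDerivAt_const u v))

theorem hasDerivAt_slice_snd {V : Type*} [NormedAddCommGroup V] [NormedSpace ℝ V]
    {f : ℝ × ℝ → V} {u v : ℝ} (hf : DifferentiableAt ℝ f (u, v)) :
    HasDerivAt (fun t => f (u, t)) (pd (0, 1) f (u, v)) v :=
  hf.hasFDerivAt.comp_hasDerivAt v ((hasDerivAt_const v u).prodMk (hasDerivAt_id v))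

theorem eq_of_hasDerivAt_zero {f : ℝ → ℝ} {s : Set ℝ} (hs : Convex ℝ s)
    (h : ∀ t ∈ s, HasDerivAt f 0 t) {a b : ℝ} (ha : a ∈ s) (hb : b ∈ s) : f a = f b := by
  have := hs.norm_image_sub_le_of_norm_hasDerivWithin_le (C := 0)
    (fun t ht => (h t ht).hasDerivWithinAt) (by simp) hb ha
  simpa [sub_eq_zero] using this

/-! ### The frame of two isotropic vectors and their unit normal -/

theorem len_cross {a b : R31} (ha : mink a a = 0) (hF : 0 < mink a b) :
    len (cross a b) = mink a b := by
  rw [len, mink_cross_self, ha, zero_mul, sub_zero, abs_of_nonneg (sq_nonneg _),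
    Real.sqrt_sq hF.le]

/-- Two isotropic vectors are dual to each other up to the factor ⟨a, b⟩, which is why the
coefficient of a is read off by pairing with b and vice versa. -/
theorem isotropic_expansion {a b : R31} (ha : mink a a = 0) (hb : mink b b = 0)
    (hF : mink a b ≠ 0) (w : R31) :
    w = (mink w b / mink a b) • a + (mink w a / mink a b) • b +
      mink w ((mink a b)⁻¹ • cross a b) • ((mink a b)⁻¹ • cross a b) := by
  have h := cross_expansion a b w
  rw [ha, hb] at h
  simp only [zero_mul, sub_zero] at h
  have h2 : w = ((mink a b ^ 2)⁻¹) • (mink a b ^ 2 • w) := by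
    rw [smul_smul, inv_mul_cancel₀ (pow_ne_zero 2 hF), one_smul]
  rw [h] at h2
  conv_lhs => rw [h2]
  rw [smul_add, smul_add, smul_smul, smul_smul, smul_smul, smul_smul, mink_smul_right]
  congr 1
  · congr 2 <;> field_simp
  · congr 1; field_simp

theorem meanH_of_isotropic {x : ℝ × ℝ → R31} {p : ℝ × ℝ} (hE : coefE x p = 0)
    (hG : coefG x p = 0) (hF : coefF x p ≠ 0) : meanH x p = coefM x p / coefF x p := by
  rw [meanH, hE, hG]; field_simp; ring

theorem gaussK_of_isotropic {x : ℝ × ℝ → R31} {p : ℝ × ℝ} (hE : coefE x p = 0) :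
    gaussK x p = -(coefL x p * coefN x p - coefM x p ^ 2) / coefF x p ^ 2 := by
  rw [gaussK, hE, zero_mul, zero_sub, div_neg, neg_div]

section Frame

variable {D : Set (ℝ × ℝ)} {p₀ p : ℝ × ℝ} {x : ℝ × ℝ → R31}

namespace IsCanonicalMinimal

theorem isOpen (h : IsCanonicalMinimal D p₀ x) : IsOpen D := h.domain.isOpen

theorem smooth (h : IsCanonicalMinimal D p₀ x) : ContDiffOn ℝ ∞ x D := h.lorentz.smooth

theorem smooth_du (h : IsCanonicalMinimal D p₀ x) : ContDiffOn ℝ ∞ (du x) D :=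
  contDiffOn_pd _ h.isOpen h.smooth

theorem smooth_dv (h : IsCanonicalMinimal D p₀ x) : ContDiffOn ℝ ∞ (dv x) D :=
  contDiffOn_pd _ h.isOpen h.smooth

theorem smooth_coefF (h : IsCanonicalMinimal D p₀ x) : ContDiffOn ℝ ∞ (coefF x) D :=
  contDiffOn_mink h.smooth_du h.smooth_dv

theorem coefE_eq (h : IsCanonicalMinimal D p₀ x) (hp : p ∈ D) : mink (du x p) (du x p) = 0 :=
  (h.canonical.1 p hp).1

theorem coefG_eq (h : IsCanonicalMinimal D p₀ x) (hp : p ∈ D) : mink (dv x p) (dv x p) = 0 :=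
  (h.canonical.1 p hp).2.1

theorem coefF_pos (h : IsCanonicalMinimal D p₀ x) (hp : p ∈ D) : 0 < coefF x p :=
  (h.canonical.1 p hp).2.2

theorem coefM_eq (h : IsCanonicalMinimal D p₀ x) (hp : p ∈ D) : coefM x p = 0 := by
  have h1 := meanH_of_isotropic (h.coefE_eq hp) (h.coefG_eq hp) (h.coefF_pos hp).ne'
  rw [h.minimal p hp, eq_comm, div_eq_zero_iff] at h1
  exact h1.resolve_right (h.coefF_pos hp).ne'

theorem unitNormal_eq (h : IsCanonicalMinimal D p₀ x) (hp : p ∈ D) :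
    unitNormal x p = (coefF x p)⁻¹ • cross (du x p) (dv x p) := by
  rw [unitNormal, len_cross (h.coefE_eq hp) (h.coefF_pos hp), coefF]

theorem smooth_unitNormal (h : IsCanonicalMinimal D p₀ x) : ContDiffOn ℝ ∞ (unitNormal x) D := by
  have h1 : ContDiffOn ℝ ∞ (fun p => (coefF x p)⁻¹ • cross (du x p) (dv x p)) D := by
    refine (h.smooth_coefF.inv fun p hp => (h.coefF_pos hp).ne').smul ?_
    have ha := contDiffOn_pi.1 h.smooth_du
    have hb := contDiffOn_pi.1 h.smooth_dv
    refine contDiffOn_pi.2 fun i => ?_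
    fin_cases i
    · exact (((ha 1).mul (hb 2)).sub ((ha 2).mul (hb 1))).neg
    · exact ((ha 2).mul (hb 0)).sub ((ha 0).mul (hb 2))
    · exact ((ha 0).mul (hb 1)).sub ((ha 1).mul (hb 0))
  exact h1.congr fun p hp => h.unitNormal_eq hp

theorem normal_du (h : IsCanonicalMinimal D p₀ x) (hp : p ∈ D) :
    mink (unitNormal x p) (du x p) = 0 := by
  rw [h.unitNormal_eq hp, mink_smul_left, mink_cross_left, mul_zero]

theorem normal_dv (h : IsCanonicalMinimal D p₀ x) (hp : p ∈ D) :
    mink (unitNormal x p) (dv x p) = 0 := by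
  rw [h.unitNormal_eq hp, mink_smul_left, mink_cross_right, mul_zero]

theorem normal_normal (h : IsCanonicalMinimal D p₀ x) (hp : p ∈ D) :
    mink (unitNormal x p) (unitNormal x p) = 1 := by
  have := (h.coefF_pos hp).ne'
  rw [h.unitNormal_eq hp, mink_smul_left, mink_smul_right, mink_cross_self, h.coefE_eq hp,
    zero_mul, sub_zero]
  change _ * (_ * coefF x p ^ 2) = 1
  field_simp

theorem expansion (h : IsCanonicalMinimal D p₀ x) (hp : p ∈ D) (w : R31) :
    w = (mink w (dv x p) / coefF x p) • du x p + (mink w (du x p) / coefF x p) • dv x p +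
      mink w (unitNormal x p) • unitNormal x p := by
  rw [h.unitNormal_eq hp]
  exact isotropic_expansion (h.coefE_eq hp) (h.coefG_eq hp) (h.coefF_pos hp).ne' w

/-! ### Derivatives of the moving frame: Gauss and Weingarten formulas -/

theorem diff_du (h : IsCanonicalMinimal D p₀ x) (hp : p ∈ D) : DifferentiableAt ℝ (du x) p :=
  h.smooth_du.differentiableAt_of_isOpen h.isOpen hp

theorem diff_dv (h : IsCanonicalMinimal D p₀ x) (hp : p ∈ D) : DifferentiableAt ℝ (dv x) p :=
  h.smooth_dv.differentiableAt_of_isOpen h.isOpen hp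

theorem diff_normal (h : IsCanonicalMinimal D p₀ x) (hp : p ∈ D) :
    DifferentiableAt ℝ (unitNormal x) p :=
  h.smooth_unitNormal.differentiableAt_of_isOpen h.isOpen hp

theorem diff_coefF (h : IsCanonicalMinimal D p₀ x) (hp : p ∈ D) :
    DifferentiableAt ℝ (coefF x) p :=
  h.smooth_coefF.differentiableAt_of_isOpen h.isOpen hp

theorem mink_pd_du_du (h : IsCanonicalMinimal D p₀ x) (hp : p ∈ D) (e : ℝ × ℝ) :
    mink (pd e (du x) p) (du x p) = 0 := by
  have h1 := pd_mink e (h.diff_du hp) (h.diff_du hp)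
  rw [pd_eq_zero_of_eq_const e h.isOpen hp (fun q hq => h.coefE_eq hq),
    mink_comm (du x p)] at h1
  linarith

theorem mink_pd_dv_dv (h : IsCanonicalMinimal D p₀ x) (hp : p ∈ D) (e : ℝ × ℝ) :
    mink (pd e (dv x) p) (dv x p) = 0 := by
  have h1 := pd_mink e (h.diff_dv hp) (h.diff_dv hp)
  rw [pd_eq_zero_of_eq_const e h.isOpen hp (fun q hq => h.coefG_eq hq),
    mink_comm (dv x p)] at h1
  linarith

theorem mink_pd_normal_normal (h : IsCanonicalMinimal D p₀ x) (hp : p ∈ D) (e : ℝ × ℝ) :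
    mink (pd e (unitNormal x) p) (unitNormal x p) = 0 := by
  have h1 := pd_mink e (h.diff_normal hp) (h.diff_normal hp)
  rw [pd_eq_zero_of_eq_const e h.isOpen hp (fun q hq => h.normal_normal hq),
    mink_comm (unitNormal x p)] at h1
  linarith

theorem mink_pd_normal_du (h : IsCanonicalMinimal D p₀ x) (hp : p ∈ D) (e : ℝ × ℝ) :
    mink (pd e (unitNormal x) p) (du x p) = -mink (pd e (du x) p) (unitNormal x p) := by
  have h1 := pd_mink e (h.diff_normal hp) (h.diff_du hp)
  rw [pd_eq_zero_of_eq_const e h.isOpen hp (fun q hq => h.normal_du hq),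
    mink_comm (unitNormal x p)] at h1
  linarith

theorem mink_pd_normal_dv (h : IsCanonicalMinimal D p₀ x) (hp : p ∈ D) (e : ℝ × ℝ) :
    mink (pd e (unitNormal x) p) (dv x p) = -mink (pd e (dv x) p) (unitNormal x p) := by
  have h1 := pd_mink e (h.diff_normal hp) (h.diff_dv hp)
  rw [pd_eq_zero_of_eq_const e h.isOpen hp (fun q hq => h.normal_dv hq),
    mink_comm (unitNormal x p)] at h1
  linarith

theorem du_dv_comm (h : IsCanonicalMinimal D p₀ x) (hp : p ∈ D) :
    pd (1, 0) (dv x) p = pd (0, 1) (du x) p :=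
  pd_comm _ h.isOpen h.smooth hp _

/-- Differentiating E = 0 in v and G = 0 in u kills the tangential components, and minimality (M =
0) kills the normal one. So the surface is locally a translation surface, and most mixed terms below
disappear. -/
theorem dv_du (h : IsCanonicalMinimal D p₀ x) (hp : p ∈ D) : pd (0, 1) (du x) p = 0 := by
  rw [h.expansion hp (pd (0, 1) (du x) p), h.mink_pd_du_du hp, ← h.du_dv_comm hp,
    h.mink_pd_dv_dv hp, h.du_dv_comm hp]
  have : mink (pd (0, 1) (du x) p) (unitNormal x p) = 0 := h.coefM_eq hp
  simp [this]

theorem du_dv (h : IsCanonicalMinimal D p₀ x) (hp : p ∈ D) : pd (1, 0) (dv x) p = 0 := by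
  rw [h.du_dv_comm hp, h.dv_du hp]

theorem du_coefF (h : IsCanonicalMinimal D p₀ x) (hp : p ∈ D) :
    pd (1, 0) (coefF x) p = mink (pd (1, 0) (du x) p) (dv x p) := by
  have h1 := pd_mink (1, 0) (h.diff_du hp) (h.diff_dv hp)
  rwa [h.du_dv hp, mink_zero_right, add_zero] at h1

theorem dv_coefF (h : IsCanonicalMinimal D p₀ x) (hp : p ∈ D) :
    pd (0, 1) (coefF x) p = mink (pd (0, 1) (dv x) p) (du x p) := by
  have h1 := pd_mink (0, 1) (h.diff_du hp) (h.diff_dv hp)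
  rwa [h.dv_du hp, mink_zero_left, zero_add, mink_comm] at h1

/-- The Gauss formula for `x_uu`. -/
theorem du_du (h : IsCanonicalMinimal D p₀ x) (hp : p ∈ D) :
    pd (1, 0) (du x) p =
      (pd (1, 0) (coefF x) p / coefF x p) • du x p + coefL x p • unitNormal x p := by
  conv_lhs => rw [h.expansion hp (pd (1, 0) (du x) p)]
  rw [h.mink_pd_du_du hp, ← h.du_coefF hp]
  simp [coefL, du_eq_pd]

/-- The Gauss formula for `x_vv`. -/
theorem dv_dv (h : IsCanonicalMinimal D p₀ x) (hp : p ∈ D) :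
    pd (0, 1) (dv x) p =
      (pd (0, 1) (coefF x) p / coefF x p) • dv x p + coefN x p • unitNormal x p := by
  conv_lhs => rw [h.expansion hp (pd (0, 1) (dv x) p)]
  rw [h.mink_pd_dv_dv hp, ← h.dv_coefF hp]
  simp [coefN, dv_eq_pd]

/-- The Weingarten formula for `l_u`. -/
theorem du_normal (h : IsCanonicalMinimal D p₀ x) (hp : p ∈ D) :
    pd (1, 0) (unitNormal x) p = -(coefL x p / coefF x p) • dv x p := by
  rw [h.expansion hp (pd (1, 0) (unitNormal x) p), h.mink_pd_normal_normal hp,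
    h.mink_pd_normal_dv hp, h.du_dv hp, mink_zero_left, h.mink_pd_normal_du hp]
  simp [coefL, du_eq_pd, neg_div]

/-- The Weingarten formula for `l_v`. -/
theorem dv_normal (h : IsCanonicalMinimal D p₀ x) (hp : p ∈ D) :
    pd (0, 1) (unitNormal x) p = -(coefN x p / coefF x p) • du x p := by
  rw [h.expansion hp (pd (0, 1) (unitNormal x) p), h.mink_pd_normal_normal hp,
    h.mink_pd_normal_dv hp, h.mink_pd_normal_du hp, h.dv_du hp, mink_zero_left]
  simp [coefN, dv_eq_pd, neg_div]

/-! ### Codazzi and Gauss equations, natural equation -/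

theorem smooth_coefL (h : IsCanonicalMinimal D p₀ x) : ContDiffOn ℝ ∞ (coefL x) D :=
  contDiffOn_mink (contDiffOn_pd _ h.isOpen h.smooth_du) h.smooth_unitNormal

theorem smooth_coefN (h : IsCanonicalMinimal D p₀ x) : ContDiffOn ℝ ∞ (coefN x) D :=
  contDiffOn_mink (contDiffOn_pd _ h.isOpen h.smooth_dv) h.smooth_unitNormal

/-- One of the Codazzi equations: `L_v = 0`. -/
theorem dv_coefL (h : IsCanonicalMinimal D p₀ x) (hp : p ∈ D) : pd (0, 1) (coefL x) p = 0 := by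
  have h1 := pd_mink (0, 1)
    ((contDiffOn_pd (1, 0) h.isOpen h.smooth_du).differentiableAt_of_isOpen h.isOpen hp)
    (h.diff_normal hp)
  -- Both terms of L_v vanish: l_v is a multiple of x_u, which is orthogonal to x_uu, and x_uuv =
  -- (x_uv)_u = 0.
  rw [pd_comm (0, 1) h.isOpen h.smooth_du hp, h.dv_normal hp, mink_smul_right,
    h.mink_pd_du_du hp,
    pd_eq_zero_of_eq_const (1, 0) h.isOpen hp (fun q hq => h.dv_du hq), mink_zero_left] at h1
  rw [mul_zero, add_zero] at h1
  exact h1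

/-- One of the Codazzi equations: `N_u = 0`. -/
theorem du_coefN (h : IsCanonicalMinimal D p₀ x) (hp : p ∈ D) : pd (1, 0) (coefN x) p = 0 := by
  have h1 := pd_mink (1, 0)
    ((contDiffOn_pd (0, 1) h.isOpen h.smooth_dv).differentiableAt_of_isOpen h.isOpen hp)
    (h.diff_normal hp)
  rw [pd_comm (1, 0) h.isOpen h.smooth_dv hp, h.du_normal hp, mink_smul_right,
    h.mink_pd_dv_dv hp,
    pd_eq_zero_of_eq_const (0, 1) h.isOpen hp (fun q hq => h.du_dv hq), mink_zero_left] at h1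
  rw [mul_zero, add_zero] at h1
  exact h1

/-- In canonical coordinates `L` and `N` are constant, equal to `±1`. -/
theorem exists_coefL_coefN (h : IsCanonicalMinimal D p₀ x) :
    ∃ ε₁ ε₂ : ℝ, (ε₁ = 1 ∨ ε₁ = -1) ∧ (ε₂ = 1 ∨ ε₂ = -1) ∧
      ∀ p ∈ D, coefL x p = ε₁ ∧ coefN x p = ε₂ := by
  obtain ⟨-, -, ε₁, ε₂, h₁, h₂, hL, hN⟩ := h.canonical
  refine ⟨ε₁, ε₂, h₁, h₂, ?_⟩
  rintro ⟨u, v⟩ hp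
  constructor
  -- Since L_v = 0, the value ε₁ on the line v = v₀ is carried along the vertical segment, which
  -- stays in D.
  · have hs := h.domain.vert u v hp
    rw [← hL u (hs _ left_mem_uIcc)]
    refine eq_of_hasDerivAt_zero (f := fun t => coefL x (u, t)) (convex_uIcc p₀.2 v)
      (fun t ht => ?_) right_mem_uIcc left_mem_uIcc
    have := hasDerivAt_slice_snd (h.smooth_coefL.differentiableAt_of_isOpen h.isOpen (hs t ht))
    rwa [h.dv_coefL (hs t ht)] at this
  · have hs := h.domain.horiz u v hp
    rw [← hN v (hs _ left_mem_uIcc)]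
    refine eq_of_hasDerivAt_zero (f := fun t => coefN x (t, v)) (convex_uIcc p₀.1 u)
      (fun t ht => ?_) right_mem_uIcc left_mem_uIcc
    have := hasDerivAt_slice_fst (h.smooth_coefN.differentiableAt_of_isOpen h.isOpen (hs t ht))
    rwa [h.du_coefN (hs t ht)] at this

theorem gaussK_eq (h : IsCanonicalMinimal D p₀ x) (hp : p ∈ D) :
    gaussK x p = -(coefL x p * coefN x p) / coefF x p ^ 2 := by
  rw [gaussK_of_isotropic (h.coefE_eq hp), h.coefM_eq hp]
  simp

/-- Because LN = ±1, the curvature alone recovers the metric. Both the natural equation and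
uniqueness rest on this. -/
theorem sqrt_abs_gaussK (h : IsCanonicalMinimal D p₀ x) (hp : p ∈ D) :
    Real.sqrt |gaussK x p| = (coefF x p)⁻¹ := by
  obtain ⟨ε₁, ε₂, h₁, h₂, hLN⟩ := h.exists_coefL_coefN
  have hF := h.coefF_pos hp
  have : |gaussK x p| = (coefF x p)⁻¹ ^ 2 := by
    rw [h.gaussK_eq hp, (hLN p hp).1, (hLN p hp).2, abs_div, abs_of_pos (pow_pos hF 2)]
    rcases h₁ with rfl | rfl <;> rcases h₂ with rfl | rfl <;> simp
  rw [this, Real.sqrt_sq (inv_pos.2 hF).le]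

/-- The Gauss equation. -/
theorem dv_du_coefF (h : IsCanonicalMinimal D p₀ x) (hp : p ∈ D) :
    pd (0, 1) (pd (1, 0) (coefF x)) p =
      pd (1, 0) (coefF x) p * pd (0, 1) (coefF x) p / coefF x p + coefL x p * coefN x p := by
  have h1 := pd_mink (0, 1)
    ((contDiffOn_pd (1, 0) h.isOpen h.smooth_du).differentiableAt_of_isOpen h.isOpen hp)
    (h.diff_dv hp)
  -- F_uv is the v-derivative of ⟨x_uu, x_v⟩. The term with x_uuv = 0 drops out, and the Gauss
  -- formula for x_vv evaluates ⟨x_uu, x_vv⟩.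
  rw [pd_congr (0, 1) h.isOpen hp fun q hq => h.du_coefF hq, h1,
    pd_comm (0, 1) h.isOpen h.smooth_du hp,
    pd_eq_zero_of_eq_const (1, 0) h.isOpen hp (fun q hq => h.dv_du hq), mink_zero_left,
    h.dv_dv hp, mink_add_right, mink_smul_right, mink_smul_right, ← h.du_coefF hp, coefL]
  change 0 + (_ + coefN x p * mink (pd (1, 0) (du x) p) (unitNormal x p)) = _ +
    mink (pd (1, 0) (du x) p) (unitNormal x p) * coefN x p
  ring

theorem solvesNatural (h : IsCanonicalMinimal D p₀ x) : SolvesNatural D (gaussK x) := by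
  obtain ⟨ε₁, ε₂, h₁, h₂, hLN⟩ := h.exists_coefL_coefN
  refine ⟨?_, ?_, ?_⟩
  · exact ((h.smooth_coefL.mul h.smooth_coefN).neg.div (h.smooth_coefF.pow 2)
      fun p hp => pow_ne_zero 2 (h.coefF_pos hp).ne').congr fun p hp => h.gaussK_eq hp
  · intro p hp
    have := h.general p hp
    rw [h.minimal p hp] at this
    simpa using this
  · intro p hp
    have hF := (h.coefF_pos hp).ne'
    have hdF : ∀ q ∈ D, pd (1, 0) (fun q => Real.log (Real.sqrt |gaussK x q|)) q =
        -(coefF x q)⁻¹ * pd (1, 0) (coefF x) q := by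
      intro q hq
      rw [pd_congr (1, 0) h.isOpen hq (g := fun q => -Real.log (coefF x q))
        (fun r hr => by rw [h.sqrt_abs_gaussK hr, Real.log_inv])]
      exact pd_real_comp (h := fun t => -Real.log t) (1, 0)
        (Real.hasDerivAt_log (h.coefF_pos hq).ne').neg (h.diff_coefF hq)
    have hd1 : DifferentiableAt ℝ (fun q => -(coefF x q)⁻¹) p := ((h.diff_coefF hp).inv hF).neg
    have hd2 : DifferentiableAt ℝ (pd (1, 0) (coefF x)) p :=
      (contDiffOn_pd (1, 0) h.isOpen h.smooth_coefF).differentiableAt_of_isOpen h.isOpen hp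
    rw [du_eq_pd, dv_eq_pd, pd_congr (0, 1) h.isOpen hp hdF, pd_mul (0, 1) hd1 hd2,
      h.sqrt_abs_gaussK hp, h.dv_du_coefF hp, h.gaussK_eq hp,
      pd_real_comp (h := fun t => -t⁻¹) (0, 1) (hasDerivAt_inv hF).neg (h.diff_coefF hp)]
    field_simp
    ring

end IsCanonicalMinimal

end Frame

/-! ### Motions -/

theorem eq_of_mink_eq {a b : R31} (h : ∀ c, mink a c = mink b c) : a = b := by
  have h0 := h ![1, 0, 0]
  have h1 := h ![0, 1, 0]
  have h2 := h ![0, 0, 1]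
  simp [mink] at h0 h1 h2
  ext i
  fin_cases i <;> simpa

section Motion

variable {A : R31 →ₗ[ℝ] R31}

theorem surjective_of_mink (hA : ∀ y z, mink (A y) (A z) = mink y z) :
    Function.Surjective A := by
  refine LinearMap.surjective_of_injective fun y z hyz => eq_of_mink_eq fun c => ?_
  rw [← hA, hyz, hA]

/-- Both sides are determinants of three vectors, so no isometry assumption is needed. -/
theorem mink_cross_map (a b c : R31) :
    mink (cross (A a) (A b)) (A c) = LinearMap.det A * mink (cross a b) c := by
  have key : ∀ v : Fin 3 → R31, Matrix.det (Matrix.of v) = (Pi.basisFun ℝ (Fin 3)).det v := by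
    intro v
    rw [Pi.basisFun_det]; rfl
  rw [mink_cross, mink_cross, key, key, ← Module.Basis.det_comp]
  congr 1
  ext i
  fin_cases i <;> rfl

theorem cross_map (hA : ∀ y z, mink (A y) (A z) = mink y z) (a b : R31) :
    cross (A a) (A b) = LinearMap.det A • A (cross a b) := by
  refine eq_of_mink_eq fun c => ?_
  obtain ⟨c, rfl⟩ := surjective_of_mink hA c
  rw [mink_cross_map, mink_smul_left, hA]

/-- The square of the cross product of two vectors depends only on their scalar products, so A
preserves it, while `cross_map` multiplies it by the squared determinant. The first two basis
vectors give a nonzero value to compare. -/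
theorem det_eq_one_or (hA : ∀ y z, mink (A y) (A z) = mink y z) :
    LinearMap.det A = 1 ∨ LinearMap.det A = -1 := by
  have h := mink_cross_self (A ![1, 0, 0]) (A ![0, 1, 0])
  rw [cross_map hA, mink_smul_left, mink_smul_right] at h
  simp only [hA] at h
  simp [mink, cross] at h
  exact mul_self_eq_one_iff.1 h

variable {D : Set (ℝ × ℝ)} {p₀ p : ℝ × ℝ} {x : ℝ × ℝ → R31} {g : R31 → R31} {b : R31}

theorem pd_motion (hg : ∀ y, g y = A y + b) (e : ℝ × ℝ) (hx : DifferentiableAt ℝ x p) :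
    pd e (fun q => g (x q)) p = A (pd e x p) := by
  have h := pd_comp e (LinearMap.toContinuousLinearMap A) hx
  have h2 := pd_add (g := fun _ => b) e
    ((LinearMap.toContinuousLinearMap A).differentiableAt.comp p hx) (differentiableAt_const b)
  rw [pd_const, add_zero] at h2
  simp only [hg]
  exact h2.trans h

theorem pd_pd_motion (hg : ∀ y, g y = A y + b) (hD : IsOpen D) (hx : ContDiffOn ℝ ∞ x D)
    (hp : p ∈ D) (e e' : ℝ × ℝ) :
    pd e (pd e' (fun q => g (x q))) p = A (pd e (pd e' x) p) := by
  rw [pd_congr e hD hp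
    (fun q hq => pd_motion hg e' (hx.differentiableAt_of_isOpen hD hq))]
  exact pd_comp e (LinearMap.toContinuousLinearMap A)
    ((contDiffOn_pd e' hD hx).differentiableAt_of_isOpen hD hp)

variable (hA : ∀ y z, mink (A y) (A z) = mink y z) (hg : ∀ y, g y = A y + b)
include hA hg

theorem coef_first_motion (hx : DifferentiableAt ℝ x p) :
    coefE (fun q => g (x q)) p = coefE x p ∧ coefF (fun q => g (x q)) p = coefF x p ∧
      coefG (fun q => g (x q)) p = coefG x p := by
  simp only [coefE, coefF, coefG, du_eq_pd, dv_eq_pd, pd_motion hg _ hx, hA, and_self]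

/-- The normal is fixed by orientation, so an improper motion reverses it. This is the only source
of signs in L, M, N. -/
theorem unitNormal_motion (hx : DifferentiableAt ℝ x p) :
    unitNormal (fun q => g (x q)) p = LinearMap.det A • A (unitNormal x p) := by
  have hδ : LinearMap.det A * LinearMap.det A = 1 := mul_self_eq_one_iff.2 (det_eq_one_or hA)
  simp only [unitNormal, du_eq_pd, dv_eq_pd, pd_motion hg _ hx, cross_map hA, len,
    mink_smul_left, mink_smul_right, hA, ← mul_assoc, hδ, one_mul, map_smul]
  rw [smul_comm]

theorem coef_second_motion (hD : IsOpen D) (hx : ContDiffOn ℝ ∞ x D) (hp : p ∈ D) :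
    coefL (fun q => g (x q)) p = LinearMap.det A * coefL x p ∧
      coefM (fun q => g (x q)) p = LinearMap.det A * coefM x p ∧
      coefN (fun q => g (x q)) p = LinearMap.det A * coefN x p := by
  simp only [coefL, coefM, coefN, unitNormal_motion hA hg (hx.differentiableAt_of_isOpen hD hp),
    du_eq_pd, dv_eq_pd, pd_pd_motion hg hD hx hp, mink_smul_right, hA, and_self]

theorem gaussK_motion (hD : IsOpen D) (hx : ContDiffOn ℝ ∞ x D) (hp : p ∈ D) :
    gaussK (fun q => g (x q)) p = gaussK x p := by
  have hδ : LinearMap.det A * LinearMap.det A = 1 := mul_self_eq_one_iff.2 (det_eq_one_or hA)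
  obtain ⟨h1, h2, h3⟩ := coef_first_motion hA hg (hx.differentiableAt_of_isOpen hD hp)
  obtain ⟨h4, h5, h6⟩ := coef_second_motion hA hg hD hx hp
  rw [gaussK, gaussK, h1, h2, h3, h4, h5, h6]
  congr 1
  linear_combination (coefL x p * coefN x p - coefM x p ^ 2) * hδ

theorem meanH_motion (hD : IsOpen D) (hx : ContDiffOn ℝ ∞ x D) (hp : p ∈ D) :
    meanH (fun q => g (x q)) p = LinearMap.det A * meanH x p := by
  obtain ⟨h1, h2, h3⟩ := coef_first_motion hA hg (hx.differentiableAt_of_isOpen hD hp)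
  obtain ⟨h4, h5, h6⟩ := coef_second_motion hA hg hD hx hp
  rw [meanH, meanH, h1, h2, h3, h4, h5, h6]
  ring

theorem IsCanonicalMinimal.motion (h : IsCanonicalMinimal D p₀ x) :
    IsCanonicalMinimal D p₀ (fun q => g (x q)) := by
  have hδ := det_eq_one_or hA
  have hF := fun p (hp : p ∈ D) =>
    coef_first_motion hA hg (h.smooth.differentiableAt_of_isOpen h.isOpen hp)
  have hS := fun p (hp : p ∈ D) => coef_second_motion hA hg h.isOpen h.smooth hp
  have hH : ∀ p ∈ D, meanH (fun q => g (x q)) p = 0 := fun p hp => by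
    rw [meanH_motion hA hg h.isOpen h.smooth hp, h.minimal p hp, mul_zero]
  refine ⟨h.domain, ⟨h.isOpen, ?_, ?_⟩, ?_, hH, ?_, h.domain.mem, ?_⟩
  · simp only [hg]
    exact ((LinearMap.toContinuousLinearMap A).contDiff.comp_contDiffOn h.smooth).add
      contDiffOn_const
  · intro p hp
    rw [(hF p hp).1, (hF p hp).2.1, (hF p hp).2.2]
    exact h.lorentz.lorentz p hp
  · intro p hp
    have := h.general p hp
    rw [h.minimal p hp] at this
    rwa [hH p hp, gaussK_motion hA hg h.isOpen h.smooth hp]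
  · intro p hp
    rw [(hF p hp).1, (hF p hp).2.1, (hF p hp).2.2]
    exact h.canonical.1 p hp
  · obtain ⟨-, -, ε₁, ε₂, h₁, h₂, hL, hN⟩ := h.canonical
    refine ⟨LinearMap.det A * ε₁, LinearMap.det A * ε₂, ?_, ?_, fun u hu => ?_, fun v hv => ?_⟩
    · rcases h₁ with rfl | rfl <;> rcases hδ with h | h <;> simp [h]
    · rcases h₂ with rfl | rfl <;> rcases hδ with h | h <;> simp [h]
    · rw [(hS _ hu).1, hL u hu]
    · rw [(hS _ hv).2.2, hN v hv]

end Motion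

/-! ### Uniqueness -/

/-- Each (u, v) is joined to p₀ by an L-shaped path with its corner at (u, v₀). -/
theorem IsCoordDomain.isPreconnected {D : Set (ℝ × ℝ)} {p₀ : ℝ × ℝ} (h : IsCoordDomain D p₀) :
    IsPreconnected D := by
  refine isPreconnected_of_forall p₀ ?_
  rintro ⟨u, v⟩ hp
  have hu : (u, p₀.2) ∈ D := h.vert u v hp _ left_mem_uIcc
  refine ⟨(uIcc p₀.1 u ×ˢ {p₀.2}) ∪ ({u} ×ˢ uIcc p₀.2 v), ?_, ?_, ?_, ?_⟩
  · rintro ⟨s, t⟩ (⟨hs, ht⟩ | ⟨hs, ht⟩)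
    · obtain rfl : t = p₀.2 := ht
      exact h.horiz u _ hu s hs
    · obtain rfl : s = u := hs
      exact h.vert _ v hp t ht
  · exact Or.inl ⟨left_mem_uIcc, rfl⟩
  · exact Or.inr ⟨rfl, right_mem_uIcc⟩
  · exact IsPreconnected.union (u, p₀.2) ⟨right_mem_uIcc, rfl⟩ ⟨rfl, left_mem_uIcc⟩
      ((convex_uIcc _ _).isPreconnected.prod isPreconnected_singleton)
      (isPreconnected_singleton.prod (convex_uIcc _ _).isPreconnected)

/-- For two surfaces in isotropic coordinates with the same `F`, the linear map carrying the frame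
`(x_u, x_v, l)` of the first one at `p` to the frame of the second one. -/
def frameMap (x y : ℝ × ℝ → R31) (p : ℝ × ℝ) : R31 →ₗ[ℝ] R31 where
  toFun w := (mink w (dv x p) / coefF x p) • du y p + (mink w (du x p) / coefF x p) • dv y p +
    mink w (unitNormal x p) • unitNormal y p
  map_add' w w' := by
    simp only [mink_add_left, add_div, add_smul]; abel
  map_smul' r w := by
    simp only [mink_smul_left, mul_div_assoc, mul_smul, smul_add, RingHom.id_apply]

section Uniqueness

variable {D : Set (ℝ × ℝ)} {p₁ p₂ p : ℝ × ℝ} {x y : ℝ × ℝ → R31}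

theorem frameMap_apply (w : R31) : frameMap x y p w =
    (mink w (dv x p) / coefF x p) • du y p + (mink w (du x p) / coefF x p) • dv y p +
      mink w (unitNormal x p) • unitNormal y p := rfl

variable (hx : IsCanonicalMinimal D p₁ x) (hy : IsCanonicalMinimal D p₂ y)
include hx

theorem frameMap_du (hp : p ∈ D) : frameMap x y p (du x p) = du y p := by
  have h1 : mink (du x p) (dv x p) = coefF x p := rfl
  rw [frameMap_apply, h1, hx.coefE_eq hp, mink_comm _ (unitNormal x p), hx.normal_du hp,
    div_self (hx.coefF_pos hp).ne']
  simp

theorem frameMap_dv (hp : p ∈ D) : frameMap x y p (dv x p) = dv y p := by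
  have h1 : mink (dv x p) (du x p) = coefF x p := mink_comm _ _
  rw [frameMap_apply, h1, hx.coefG_eq hp, mink_comm _ (unitNormal x p), hx.normal_dv hp,
    div_self (hx.coefF_pos hp).ne']
  simp

include hy

/-- The two frames have the same Gram matrix, whose only varying entry is F. -/
theorem mink_frameMap (hF : ∀ q ∈ D, coefF y q = coefF x q) (hp : p ∈ D) (w w' : R31) :
    mink (frameMap x y p w) (frameMap x y p w') = mink w w' := by
  have hn := (hx.coefF_pos hp).ne'
  have e1 : mink (du y p) (dv y p) = coefF x p := hF p hp
  have e2 : mink (dv y p) (du y p) = coefF x p := (mink_comm _ _).trans (hF p hp)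
  have e3 : mink (du x p) w' = mink w' (du x p) := mink_comm _ _
  have e4 : mink (dv x p) w' = mink w' (dv x p) := mink_comm _ _
  have e5 : mink (unitNormal x p) w' = mink w' (unitNormal x p) := mink_comm _ _
  have e6 := (mink_comm _ _).trans (hy.normal_du hp)
  have e7 := (mink_comm _ _).trans (hy.normal_dv hp)
  conv_rhs => rw [hx.expansion hp w]
  simp only [frameMap_apply, mink_add_left, mink_add_right, mink_smul_left, mink_smul_right,
    hy.coefE_eq hp, hy.coefG_eq hp, hy.normal_du hp, hy.normal_dv hp, hy.normal_normal hp,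
    e1, e2, e3, e4, e5, e6, e7]
  field_simp
  ring

theorem pd_frameMap (e : ℝ × ℝ) (hp : p ∈ D) (w : R31) :
    pd e (fun q => frameMap x y q w) p =
      ((mink w (dv x p) / coefF x p) • pd e (du y) p +
        (mink w (pd e (dv x) p) / coefF x p -
          mink w (dv x p) * pd e (coefF x) p / coefF x p ^ 2) • du y p) +
      ((mink w (du x p) / coefF x p) • pd e (dv y) p +
        (mink w (pd e (du x) p) / coefF x p -
          mink w (du x p) * pd e (coefF x) p / coefF x p ^ 2) • dv y p) +
      (mink w (unitNormal x p) • pd e (unitNormal y) p +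
        mink w (pd e (unitNormal x) p) • unitNormal y p) := by
  have hn := (hx.coefF_pos hp).ne'
  have hw : DifferentiableAt ℝ (fun _ : ℝ × ℝ => w) p := differentiableAt_const w
  have hm : ∀ f : ℝ × ℝ → R31, DifferentiableAt ℝ f p →
      DifferentiableAt ℝ (fun q => mink w (f q)) p := fun f hf =>
    (minkL w).differentiableAt.comp p hf
  have hmd : ∀ f : ℝ × ℝ → R31, DifferentiableAt ℝ f p →
      pd e (fun q => mink w (f q)) p = mink w (pd e f p) := fun f hf => by
    rw [pd_mink e hw hf, pd_const, mink_zero_left, zero_add]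
  have hq : ∀ f : ℝ × ℝ → R31, DifferentiableAt ℝ f p →
      DifferentiableAt ℝ (fun q => mink w (f q) / coefF x q) p := fun f hf => by
    simpa only [div_eq_mul_inv] using (hm f hf).fun_mul ((hx.diff_coefF hp).fun_inv hn)
  have hqd : ∀ f : ℝ × ℝ → R31, DifferentiableAt ℝ f p →
      pd e (fun q => mink w (f q) / coefF x q) p =
        mink w (pd e f p) / coefF x p - mink w (f p) * pd e (coefF x) p / coefF x p ^ 2 := by
    intro f hf
    simp only [div_eq_mul_inv (mink w (f _))]
    rw [pd_mul e (hm f hf) ((hx.diff_coefF hp).fun_inv hn), hmd f hf,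
      pd_real_comp (h := fun t => t⁻¹) e (hasDerivAt_inv hn) (hx.diff_coefF hp)]
    field_simp
    ring
  have d1 := (hq _ (hx.diff_dv hp)).smul (hy.diff_du hp)
  have d2 := (hq _ (hx.diff_du hp)).smul (hy.diff_dv hp)
  have d3 := (hm _ (hx.diff_normal hp)).smul (hy.diff_normal hp)
  have e1 := pd_add e (d1.add d2) d3
  have e2 := pd_add e d1 d2
  rw [← hqd _ (hx.diff_dv hp), ← hqd _ (hx.diff_du hp), ← hmd _ (hx.diff_normal hp),
    ← pd_smul e (hq _ (hx.diff_dv hp)) (hy.diff_du hp),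
    ← pd_smul e (hq _ (hx.diff_du hp)) (hy.diff_dv hp),
    ← pd_smul e (hm _ (hx.diff_normal hp)) (hy.diff_normal hp)]
  exact e1.trans (congrArg (· + _) e2)

/-- The coefficients of the Gauss-Weingarten system are functions of F, L, N. Two frames solving the
same linear system differ by a constant linear map: all terms of the derivative cancel in both
directions. -/
theorem frameMap_const (hF : ∀ q ∈ D, coefF y q = coefF x q)
    (hL : ∀ q ∈ D, coefL y q = coefL x q) (hN : ∀ q ∈ D, coefN y q = coefN x q) {q : ℝ × ℝ}
    (hp : p ∈ D) (hq : q ∈ D) : frameMap x y p = frameMap x y q := by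
  have hmw : ∀ (w : R31) {f : ℝ × ℝ → R31}, ContDiffOn ℝ ∞ f D →
      ContDiffOn ℝ ∞ (fun q => mink w (f q)) D := fun w f hf =>
    contDiffOn_mink contDiffOn_const hf
  have hn : ∀ q ∈ D, coefF x q ≠ 0 := fun q hq => (hx.coefF_pos hq).ne'
  ext1 i
  refine LinearMap.ext fun r => ?_
  -- Extensionality has reduced the claim to multiples of basis vectors; their special form plays no
  -- role.
  generalize hw : LinearMap.single ℝ (fun _ : Fin 3 => ℝ) i r = w
  simp only [LinearMap.comp_apply, hw]
  refine eq_of_pd_eq_zero (f := fun q => frameMap x y q w) hx.isOpen hx.domain.isPreconnected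
    ?_ ?_ ?_ hp hq
  · exact ((((hmw w hx.smooth_dv).div hx.smooth_coefF hn).smul hy.smooth_du).add
      (((hmw w hx.smooth_du).div hx.smooth_coefF hn).smul hy.smooth_dv)).add
      ((hmw w hx.smooth_unitNormal).smul hy.smooth_unitNormal)
  · intro p hp
    have hFp := hn p hp
    rw [pd_frameMap hx hy (1, 0) hp w, hx.du_du hp, hx.du_dv hp, hx.du_normal hp, hy.du_du hp,
      hy.du_dv hp, hy.du_normal hp, pd_congr (1, 0) hx.isOpen hp hF, hF p hp, hL p hp]
    simp only [mink_add_right, mink_smul_right, mink_zero_right]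
    ext j
    simp only [Pi.add_apply, Pi.smul_apply, smul_eq_mul, Pi.zero_apply]
    field_simp
    ring
  · intro p hp
    have hFp := hn p hp
    rw [pd_frameMap hx hy (0, 1) hp w, hx.dv_dv hp, hx.dv_du hp, hx.dv_normal hp, hy.dv_dv hp,
      hy.dv_du hp, hy.dv_normal hp, pd_congr (0, 1) hx.isOpen hp hF, hF p hp, hN p hp]
    simp only [mink_add_right, mink_smul_right, mink_zero_right]
    ext j
    simp only [Pi.add_apply, Pi.smul_apply, smul_eq_mul, Pi.zero_apply]
    field_simp
    ring

/-- With A the constant frame map, y - A x has vanishing first derivatives, hence is the translation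
part of the motion. -/
theorem exists_motion_of_coef_eq (hF : ∀ q ∈ D, coefF y q = coefF x q)
    (hL : ∀ q ∈ D, coefL y q = coefL x q) (hN : ∀ q ∈ D, coefN y q = coefN x q) :
    ∃ g : R31 → R31, IsMotion g ∧ ∀ p ∈ D, y p = g (x p) := by
  have h₁ : p₁ ∈ D := hx.domain.mem
  let A := frameMap x y p₁
  let A' := LinearMap.toContinuousLinearMap A
  refine ⟨fun z => A z + (y p₁ - A (x p₁)), ⟨A, _, mink_frameMap hx hy hF h₁, fun _ => rfl⟩, ?_⟩
  intro p hp
  have hd : ∀ q ∈ D, ∀ e, pd e (fun q => y q - A' (x q)) q = pd e y q - A' (pd e x q) := by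
    intro q hq e
    have h1 := hx.smooth.differentiableAt_of_isOpen hx.isOpen hq
    have h2 := pd_sub e (hy.smooth.differentiableAt_of_isOpen hx.isOpen hq)
      (A'.differentiableAt.comp q h1)
    exact h2.trans (congrArg (_ - ·) (pd_comp e A' h1))
  have := eq_of_pd_eq_zero (f := fun q => y q - A' (x q)) hx.isOpen hx.domain.isPreconnected
    (hy.smooth.sub (A'.contDiff.comp_contDiffOn hx.smooth))
    (fun q hq => by
      rw [hd q hq, sub_eq_zero]
      change du y q = frameMap x y p₁ (du x q)
      rw [frameMap_const hx hy hF hL hN h₁ hq, frameMap_du hx hq])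
    (fun q hq => by
      rw [hd q hq, sub_eq_zero]
      change dv y q = frameMap x y p₁ (dv x q)
      rw [frameMap_const hx hy hF hL hN h₁ hq, frameMap_dv hx hq]) hp h₁
  change y p - A (x p) = y p₁ - A (x p₁) at this
  change y p = A (x p) + (y p₁ - A (x p₁))
  rw [← this]; abel

theorem exists_motion (hK : ∀ q ∈ D, gaussK y q = gaussK x q) :
    ∃ g : R31 → R31, IsMotion g ∧ ∀ p ∈ D, y p = g (x p) := by
  have hF : ∀ q ∈ D, coefF y q = coefF x q := fun q hq => by
    have h1 := hy.sqrt_abs_gaussK hq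
    rw [hK q hq, hx.sqrt_abs_gaussK hq] at h1
    exact (inv_injective h1).symm
  have h₁ : p₁ ∈ D := hx.domain.mem
  obtain ⟨ε₁, ε₂, hε₁, hε₂, hx'⟩ := hx.exists_coefL_coefN
  obtain ⟨δ₁, δ₂, hδ₁, hδ₂, hy'⟩ := hy.exists_coefL_coefN
  have hprod : δ₁ * δ₂ = ε₁ * ε₂ := by
    have h2 := hK p₁ h₁
    rw [hx.gaussK_eq h₁, hy.gaussK_eq h₁, hF p₁ h₁, (hx' p₁ h₁).1, (hx' p₁ h₁).2, (hy' p₁ h₁).1,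
      (hy' p₁ h₁).2, div_left_inj' (pow_ne_zero 2 (hx.coefF_pos h₁).ne')] at h2
    linarith
  by_cases hs : δ₁ = ε₁
  · have hs2 : δ₂ = ε₂ := by
      subst hs
      rcases hδ₁ with rfl | rfl <;> linarith
    exact exists_motion_of_coef_eq hx hy hF
      (fun q hq => by rw [(hx' q hq).1, (hy' q hq).1, hs])
      (fun q hq => by rw [(hx' q hq).2, (hy' q hq).2, hs2])
  · have hs1 : δ₁ = -ε₁ := by
      rcases hδ₁ with rfl | rfl <;> rcases hε₁ with rfl | rfl <;> simp_all
    have hs2 : δ₂ = -ε₂ := by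
      subst hs1
      rcases hε₁ with rfl | rfl <;> linarith
    -- In the case of opposite signs, x is replaced by -x: in dimension three -id has determinant
    -- -1, so it flips L and N together and keeps F.
    have hA : ∀ y z, mink ((-LinearMap.id : R31 →ₗ[ℝ] R31) y) ((-LinearMap.id : R31 →ₗ[ℝ] R31) z)
        = mink y z := fun y z => by simp [mink]
    have hg : ∀ z : R31, -z = (-LinearMap.id : R31 →ₗ[ℝ] R31) z + 0 := fun z => by simp
    have hdet : LinearMap.det (-LinearMap.id : R31 →ₗ[ℝ] R31) = -1 := by
      have e : (-LinearMap.id : R31 →ₗ[ℝ] R31) = (-1 : ℝ) • LinearMap.id := (neg_one_smul ℝ _).symm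
      rw [e, LinearMap.det_smul, LinearMap.det_id]
      norm_num
    have hm := hx.motion hA hg
    obtain ⟨g, ⟨A, b, hA2, hg2⟩, h⟩ := exists_motion_of_coef_eq hm hy
      (fun q hq => by
        rw [hF q hq,
          (coef_first_motion hA hg (hx.smooth.differentiableAt_of_isOpen hx.isOpen hq)).2.1])
      (fun q hq => by
        rw [(coef_second_motion hA hg hx.isOpen hx.smooth hq).1, hdet, (hx' q hq).1,
          (hy' q hq).1, hs1, neg_one_mul])
      (fun q hq => by
        rw [(coef_second_motion hA hg hx.isOpen hx.smooth hq).2.2, hdet, (hx' q hq).2,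
          (hy' q hq).2, hs2, neg_one_mul])
    refine ⟨fun z => g (-z), ⟨-A, b, fun z w => ?_, fun z => ?_⟩, h⟩
    · rw [← hA2 z w]; simp [mink]
    · simp [hg2]

end Uniqueness

/-! ### Separation of variables for the Liouville equation -/

/-- The u-derivative of the equation says that τ_uu/τ does not depend on v. So τ(·, v) for every v,
and also τ_v(·, v₀), solve one linear equation y'' = q(u) y. Their Wronskians are constant in u, and
Cramer's rule writes τ(·, v) through τ(·, v₀) and τ_v(·, v₀) with coefficients depending on v only.
-/
theorem exists_separation {I J : Set ℝ} (hI : IsOpen I) (hJ : IsOpen J) (hIc : Convex ℝ I)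
    (hJc : Convex ℝ J) {u₀ v₀ : ℝ} (hu₀ : u₀ ∈ I) (hv₀ : v₀ ∈ J) {τ : ℝ × ℝ → ℝ}
    (hτ : ContDiffOn ℝ ∞ τ (I ×ˢ J)) (hpos : ∀ p ∈ I ×ˢ J, 0 < τ p) {ε : ℝ} (hε : ε ^ 2 = 1)
    (heq : ∀ p ∈ I ×ˢ J,
      τ p * pd (0, 1) (pd (1, 0) τ) p - pd (1, 0) τ p * pd (0, 1) τ p = ε / 4) :
    ∃ y₁ y₂ z₁ z₂ : ℝ → ℝ, ContDiffOn ℝ ∞ y₁ I ∧ ContDiffOn ℝ ∞ y₂ I ∧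
      ContDiffOn ℝ ∞ z₁ J ∧ ContDiffOn ℝ ∞ z₂ J ∧
      (∀ u ∈ I, y₁ u * deriv y₂ u - y₂ u * deriv y₁ u = ε / 2) ∧
      (∀ v ∈ J, z₁ v * deriv z₂ v - z₂ v * deriv z₁ v = 1 / 2) ∧
      ∀ u ∈ I, ∀ v ∈ J, y₁ u * z₂ v - y₂ u * z₁ v = τ (u, v) := by
  have hU : IsOpen (I ×ˢ J) := hI.prod hJ
  have su := contDiffOn_pd (1, 0) hU hτ
  have sv := contDiffOn_pd (0, 1) hU hτ
  have suu := contDiffOn_pd (1, 0) hU su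
  have suv := contDiffOn_pd (0, 1) hU su
  have slice₁ : ∀ {f : ℝ × ℝ → ℝ}, ContDiffOn ℝ ∞ f (I ×ˢ J) → ∀ v ∈ J,
      ContDiffOn ℝ ∞ (fun u => f (u, v)) I := fun hf v hv =>
    hf.comp (contDiff_id.prodMk contDiff_const).contDiffOn fun u hu => ⟨hu, hv⟩
  have slice₂ : ∀ {f : ℝ × ℝ → ℝ}, ContDiffOn ℝ ∞ f (I ×ˢ J) → ∀ u ∈ I,
      ContDiffOn ℝ ∞ (fun v => f (u, v)) J := fun hf u hu =>
    hf.comp (contDiff_const.prodMk contDiff_id).contDiffOn fun v hv => ⟨hu, hv⟩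
  have d₁ : ∀ {f : ℝ × ℝ → ℝ}, ContDiffOn ℝ ∞ f (I ×ˢ J) → ∀ u ∈ I, ∀ v ∈ J,
      HasDerivAt (fun t => f (t, v)) (pd (1, 0) f (u, v)) u := fun hf u hu v hv =>
    hasDerivAt_slice_fst (hf.differentiableAt_of_isOpen hU ⟨hu, hv⟩)
  have d₂ : ∀ {f : ℝ × ℝ → ℝ}, ContDiffOn ℝ ∞ f (I ×ˢ J) → ∀ u ∈ I, ∀ v ∈ J,
      HasDerivAt (fun t => f (u, t)) (pd (0, 1) f (u, v)) v := fun hf u hu v hv =>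
    hasDerivAt_slice_snd (hf.differentiableAt_of_isOpen hU ⟨hu, hv⟩)
  have hvu : ∀ p ∈ I ×ˢ J, pd (1, 0) (pd (0, 1) τ) p = pd (0, 1) (pd (1, 0) τ) p :=
    fun p hp => pd_comm _ hU hτ hp _
  -- differentiating the equation with respect to `u`
  have huuv : ∀ p ∈ I ×ˢ J, τ p * pd (0, 1) (pd (1, 0) (pd (1, 0) τ)) p =
      pd (1, 0) (pd (1, 0) τ) p * pd (0, 1) τ p := by
    intro p hp
    have dτ := hτ.differentiableAt_of_isOpen hU hp
    have du' := su.differentiableAt_of_isOpen hU hp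
    have dv' := sv.differentiableAt_of_isOpen hU hp
    have duv := suv.differentiableAt_of_isOpen hU hp
    have h := pd_sub (1, 0) (dτ.mul duv) (du'.mul dv')
    have h0 := pd_eq_zero_of_eq_const (1, 0) hU hp heq
    have h1 := pd_mul (1, 0) dτ duv
    have h2 := pd_mul (1, 0) du' dv'
    rw [hvu p hp] at h2
    rw [pd_comm (1, 0) hU su hp (0, 1)] at h1
    have h3 := (h0.symm.trans h).trans (congrArg₂ (· - ·) h1 h2)
    linarith
  have hquot : ∀ u ∈ I, ∀ v ∈ J,
      pd (1, 0) (pd (1, 0) τ) (u, v) * τ (u, v₀) = pd (1, 0) (pd (1, 0) τ) (u, v₀) * τ (u, v) := by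
    intro u hu v hv
    have h := eq_of_hasDerivAt_zero (f := fun t => pd (1, 0) (pd (1, 0) τ) (u, t) / τ (u, t)) hJc
      (fun t ht => by
        have hne := (hpos (u, t) ⟨hu, ht⟩).ne'
        refine ((d₂ suu u hu t ht).fun_div (d₂ hτ u hu t ht) hne).congr_deriv ?_
        rw [← huuv (u, t) ⟨hu, ht⟩]
        ring) hv hv₀
    exact (div_eq_div_iff (hpos (u, v) ⟨hu, hv⟩).ne' (hpos (u, v₀) ⟨hu, hv₀⟩).ne').1 h
  have hW₁ : ∀ u ∈ I, ∀ v ∈ J,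
      τ (u, v) * pd (0, 1) (pd (1, 0) τ) (u, v₀) - pd (1, 0) τ (u, v) * pd (0, 1) τ (u, v₀) =
      τ (u₀, v) * pd (0, 1) (pd (1, 0) τ) (u₀, v₀) -
        pd (1, 0) τ (u₀, v) * pd (0, 1) τ (u₀, v₀) := by
    intro u hu v hv
    refine eq_of_hasDerivAt_zero (f := fun t => τ (t, v) * pd (0, 1) (pd (1, 0) τ) (t, v₀) -
      pd (1, 0) τ (t, v) * pd (0, 1) τ (t, v₀)) hIc (fun t ht => ?_) hu hu₀
    have hne := (hpos (t, v₀) ⟨ht, hv₀⟩).ne'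
    refine (((d₁ hτ t ht v hv).fun_mul (d₁ suv t ht v₀ hv₀)).fun_sub
      ((d₁ su t ht v hv).fun_mul (d₁ sv t ht v₀ hv₀))).congr_deriv ?_
    rw [hvu _ ⟨ht, hv₀⟩, pd_comm (1, 0) hU su ⟨ht, hv₀⟩ (0, 1)]
    apply mul_left_cancel₀ hne
    linear_combination τ (t, v) * huuv (t, v₀) ⟨ht, hv₀⟩ -
      pd (0, 1) τ (t, v₀) * hquot t ht v hv
  have hW₂ : ∀ u ∈ I, ∀ v ∈ J,
      τ (u, v) * pd (1, 0) τ (u, v₀) - pd (1, 0) τ (u, v) * τ (u, v₀) =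
      τ (u₀, v) * pd (1, 0) τ (u₀, v₀) - pd (1, 0) τ (u₀, v) * τ (u₀, v₀) := by
    intro u hu v hv
    refine eq_of_hasDerivAt_zero (f := fun t => τ (t, v) * pd (1, 0) τ (t, v₀) -
      pd (1, 0) τ (t, v) * τ (t, v₀)) hIc (fun t ht => ?_) hu hu₀
    refine (((d₁ hτ t ht v hv).fun_mul (d₁ su t ht v₀ hv₀)).fun_sub
      ((d₁ su t ht v hv).fun_mul (d₁ hτ t ht v₀ hv₀))).congr_deriv ?_
    linear_combination -hquot t ht v hv
  -- z₁ and z₂ are Wronskians of τ(·, v) with τ(·, v₀) and τ_v(·, v₀), evaluated at u₀. By the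
  -- equation at v₀ the basis Wronskian is ε/4, with inverse 4ε as ε² = 1; the factor 2 in y₁ is
  -- compensated by 2ε in place of 4ε in z₂.
  refine ⟨fun u => 2 * τ (u, v₀), fun u => pd (0, 1) τ (u, v₀),
    fun v => 4 * ε * (τ (u₀, v) * pd (1, 0) τ (u₀, v₀) - pd (1, 0) τ (u₀, v) * τ (u₀, v₀)),
    fun v => 2 * ε * (τ (u₀, v) * pd (0, 1) (pd (1, 0) τ) (u₀, v₀) -
      pd (1, 0) τ (u₀, v) * pd (0, 1) τ (u₀, v₀)),
    contDiffOn_const.mul (slice₁ hτ v₀ hv₀), slice₁ sv v₀ hv₀,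
    contDiffOn_const.mul (((slice₂ hτ u₀ hu₀).mul contDiffOn_const).sub
      ((slice₂ su u₀ hu₀).mul contDiffOn_const)),
    contDiffOn_const.mul (((slice₂ hτ u₀ hu₀).mul contDiffOn_const).sub
      ((slice₂ su u₀ hu₀).mul contDiffOn_const)), ?_, ?_, ?_⟩
  · intro u hu
    rw [(d₁ sv u hu v₀ hv₀).deriv, ((d₁ hτ u hu v₀ hv₀).const_mul 2).deriv, hvu _ ⟨hu, hv₀⟩]
    linear_combination 2 * heq (u, v₀) ⟨hu, hv₀⟩
  · intro v hv
    have e1 := d₂ hτ u₀ hu₀ v hv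
    have e2 := d₂ su u₀ hu₀ v hv
    rw [(((e1.mul_const _).fun_sub (e2.mul_const _)).const_mul (2 * ε)).deriv,
      (((e1.mul_const _).fun_sub (e2.mul_const _)).const_mul (4 * ε)).deriv]
    have k1 := heq (u₀, v) ⟨hu₀, hv⟩
    have k0 := heq (u₀, v₀) ⟨hu₀, hv₀⟩
    linear_combination 8 * ε ^ 2 * (τ (u₀, v) * pd (0, 1) (pd (1, 0) τ) (u₀, v) -
      pd (1, 0) τ (u₀, v) * pd (0, 1) τ (u₀, v)) * k0 + 2 * ε ^ 3 * k1 +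
      (1 / 2) * (ε ^ 2 + 1) * hε
  · intro u hu v hv
    have k0 := heq (u, v₀) ⟨hu, hv₀⟩
    beta_reduce
    rw [← hW₁ u hu v hv, ← hW₂ u hu v hv]
    linear_combination 4 * ε * τ (u, v) * k0 + τ (u, v) * hε

/-! ### Surfaces of translation -/

theorem exists_primitive {V : Type*} [NormedAddCommGroup V] [NormedSpace ℝ V] [CompleteSpace V]
    {I : Set ℝ} (hI : IsOpen I) (hIc : Convex ℝ I) {a : ℝ → V} (ha : ContDiffOn ℝ ∞ a I) :
    ∃ α : ℝ → V, ContDiffOn ℝ ∞ α I ∧ ∀ t ∈ I, HasDerivAt α (a t) t := by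
  rcases I.eq_empty_or_nonempty with rfl | ⟨t₀, ht₀⟩
  · exact ⟨0, by simp⟩
  have hd : ∀ t ∈ I, HasDerivAt (fun s => ∫ r in t₀..s, a r) (a t) t := fun t ht =>
    intervalIntegral.integral_hasDerivAt_right
      ((ha.continuousOn.mono (hIc.ordConnected.uIcc_subset ht₀ ht)).intervalIntegrable)
      (ha.continuousOn.stronglyMeasurableAtFilter hI t ht)
      (ha.continuousOn.continuousAt (hI.mem_nhds ht))
  refine ⟨_, (contDiffOn_infty_iff_deriv_of_isOpen hI).2 ⟨fun t ht =>
    (hd t ht).differentiableAt.differentiableWithinAt, ha.congr fun t ht => (hd t ht).deriv⟩, hd⟩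

theorem pd_comp_fst {V : Type*} [NormedAddCommGroup V] [NormedSpace ℝ V] {a : ℝ → V} {a' : V}
    {p : ℝ × ℝ} (ha : HasDerivAt a a' p.1) (e : ℝ × ℝ) :
    pd e (fun q => a q.1) p = e.1 • a' := by
  have := ha.hasFDerivAt.comp p (hasFDerivAt_fst (𝕜 := ℝ) (p := p))
  have h := this.fderiv
  simp only [pd]
  erw [h]
  simp

theorem pd_comp_snd {V : Type*} [NormedAddCommGroup V] [NormedSpace ℝ V] {a : ℝ → V} {a' : V}
    {p : ℝ × ℝ} (ha : HasDerivAt a a' p.2) (e : ℝ × ℝ) :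
    pd e (fun q => a q.2) p = e.2 • a' := by
  have := ha.hasFDerivAt.comp p (hasFDerivAt_snd (𝕜 := ℝ) (p := p))
  have h := this.fderiv
  simp only [pd]
  erw [h]
  simp

/-! ### Isotropic curves from spinors -/

/-- The isotropic vector given by the square of a spinor. -/
def spinorSq (s t : ℝ) : R31 := ![s ^ 2 + t ^ 2, s ^ 2 - t ^ 2, 2 * (s * t)]

/-- Half the polarisation of `spinorSq`. -/
def spinorMul (s t s' t' : ℝ) : R31 := ![s * s' + t * t', s * s' - t * t', s * t' + t * s']

theorem mink_spinorSq (s t : ℝ) : mink (spinorSq s t) (spinorSq s t) = 0 := by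
  simp [mink, spinorSq]; ring

/-- Up to the factor -2 the scalar product of two spinor squares is the square of the area form of
the spinors; this is how F = 2τ² arises. -/
theorem mink_spinorSq_spinorSq (s t p q : ℝ) :
    mink (spinorSq s t) (spinorSq p q) = -2 * (s * q - t * p) ^ 2 := by
  simp [mink, spinorSq]; ring

theorem hasDerivAt_spinorSq {y₁ y₂ : ℝ → ℝ} {y₁' y₂' u : ℝ} (h₁ : HasDerivAt y₁ y₁' u)
    (h₂ : HasDerivAt y₂ y₂' u) :
    HasDerivAt (fun t => spinorSq (y₁ t) (y₂ t))
      ((2 : ℝ) • spinorMul (y₁ u) (y₂ u) y₁' y₂') u := by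
  rw [hasDerivAt_pi]
  intro i
  fin_cases i
  · refine ((h₁.fun_pow 2).fun_add (h₂.fun_pow 2)).congr_deriv ?_
    simp [spinorMul]; ring
  · refine ((h₁.fun_pow 2).fun_sub (h₂.fun_pow 2)).congr_deriv ?_
    simp [spinorMul]; ring
  · refine ((h₁.fun_mul h₂).const_mul 2).congr_deriv ?_
    simp [spinorMul]; ring

theorem contDiffOn_spinorSq {I : Set ℝ} {y₁ y₂ : ℝ → ℝ} (h₁ : ContDiffOn ℝ ∞ y₁ I)
    (h₂ : ContDiffOn ℝ ∞ y₂ I) : ContDiffOn ℝ ∞ (fun t => spinorSq (y₁ t) (y₂ t)) I := by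
  refine contDiffOn_pi.2 fun i => ?_
  fin_cases i
  · exact (h₁.pow 2).add (h₂.pow 2)
  · exact (h₁.pow 2).sub (h₂.pow 2)
  · exact contDiffOn_const.mul (h₁.mul h₂)

/-- The numerator of L up to a constant: F times the Wronskian, so that division by F leaves a
constant. -/
theorem mink_spinorMul_cross (s t s' t' p q : ℝ) :
    mink (spinorMul s t s' t') (cross (spinorSq s t) (spinorSq p q)) =
      -2 * (s * q - t * p) ^ 2 * (s * t' - t * s') := by
  simp [mink, spinorSq, spinorMul, cross]; ring

theorem mink_spinorMul_cross' (s t p q p' q' : ℝ) :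
    mink (spinorMul p q p' q') (cross (spinorSq s t) (spinorSq p q)) =
      2 * (s * q - t * p) ^ 2 * (p * q' - q * p') := by
  simp [mink, spinorSq, spinorMul, cross]; ring

theorem cross_neg_right (a b : R31) : cross a (-b) = (-1 : ℝ) • cross a b := by
  ext i
  fin_cases i <;> simp [cross] <;> ring

theorem isCoordDomain_prod {I J : Set ℝ} (hI : IsOpen I) (hJ : IsOpen J) (hIc : Convex ℝ I)
    (hJc : Convex ℝ J) {p₀ : ℝ × ℝ} (h₀ : p₀ ∈ I ×ˢ J) : IsCoordDomain (I ×ˢ J) p₀ where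
  isOpen := hI.prod hJ
  mem := h₀
  vert _ _ hp _ hs := ⟨hp.1, hJc.ordConnected.uIcc_subset h₀.2 hp.2 hs⟩
  horiz _ _ hp _ hs := ⟨hIc.ordConnected.uIcc_subset h₀.1 hp.1 hs, hp.2⟩

/-- A minimal surface from two curves of spinors with constant Wronskians. -/
theorem exists_canonicalMinimal_of_spinors {I J : Set ℝ} (hI : IsOpen I) (hJ : IsOpen J)
    (hIc : Convex ℝ I) (hJc : Convex ℝ J) {p₀ : ℝ × ℝ} (h₀ : p₀ ∈ I ×ˢ J) {ε : ℝ}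
    (hε : ε = 1 ∨ ε = -1) {y₁ y₂ z₁ z₂ : ℝ → ℝ} (hy₁ : ContDiffOn ℝ ∞ y₁ I)
    (hy₂ : ContDiffOn ℝ ∞ y₂ I) (hz₁ : ContDiffOn ℝ ∞ z₁ J) (hz₂ : ContDiffOn ℝ ∞ z₂ J)
    (hy : ∀ u ∈ I, y₁ u * deriv y₂ u - y₂ u * deriv y₁ u = ε / 2)
    (hz : ∀ v ∈ J, z₁ v * deriv z₂ v - z₂ v * deriv z₁ v = 1 / 2)
    (hyz : ∀ p ∈ I ×ˢ J, y₁ p.1 * z₂ p.2 - y₂ p.1 * z₁ p.2 ≠ 0) :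
    ∃ x : ℝ × ℝ → R31, IsCanonicalMinimal (I ×ˢ J) p₀ x ∧ ∀ p ∈ I ×ˢ J,
      gaussK x p = -ε / (2 * (y₁ p.1 * z₂ p.2 - y₂ p.1 * z₁ p.2) ^ 2) ^ 2 := by
  have hU : IsOpen (I ×ˢ J) := hI.prod hJ
  have sS := contDiffOn_spinorSq hy₁ hy₂
  have sT := contDiffOn_spinorSq hz₁ hz₂
  obtain ⟨α, sα, hα⟩ := exists_primitive hI hIc sS
  obtain ⟨β, sβ, hβ⟩ := exists_primitive hJ hJc sT.neg
  have hd : ∀ {f : ℝ → ℝ} {s : Set ℝ}, IsOpen s → ContDiffOn ℝ ∞ f s → ∀ t ∈ s,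
      HasDerivAt f (deriv f t) t := fun hs hf t ht =>
    ((hf.contDiffAt (hs.mem_nhds ht)).differentiableAt (by simp)).hasDerivAt
  have hS : ∀ u ∈ I, HasDerivAt (fun t => spinorSq (y₁ t) (y₂ t)) _ u := fun u hu =>
    hasDerivAt_spinorSq (hd hI hy₁ u hu) (hd hI hy₂ u hu)
  have hT : ∀ v ∈ J, HasDerivAt (fun t => -spinorSq (z₁ t) (z₂ t)) _ v := fun v hv =>
    (hasDerivAt_spinorSq (hd hJ hz₁ v hv) (hd hJ hz₂ v hv)).fun_neg
  -- A sum of isotropic curves: x_uv = 0 gives M = 0. The minus sign built into β makes F positive.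
  let x : ℝ × ℝ → R31 := fun p => α p.1 + β p.2
  have sx : ContDiffOn ℝ ∞ x (I ×ˢ J) :=
    (sα.comp contDiff_fst.contDiffOn fun p hp => hp.1).add
      (sβ.comp contDiff_snd.contDiffOn fun p hp => hp.2)
  have hx : ∀ p ∈ I ×ˢ J, ∀ e : ℝ × ℝ, pd e x p =
      e.1 • spinorSq (y₁ p.1) (y₂ p.1) + e.2 • -spinorSq (z₁ p.2) (z₂ p.2) := by
    intro p hp e
    rw [← pd_comp_fst (hα _ hp.1) e, ← pd_comp_snd (hβ _ hp.2) e]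
    exact pd_add e ((hα _ hp.1).differentiableAt.comp p differentiableAt_fst)
      ((hβ _ hp.2).differentiableAt.comp p differentiableAt_snd)
  have hdu : ∀ p ∈ I ×ˢ J, du x p = spinorSq (y₁ p.1) (y₂ p.1) := fun p hp => by
    rw [du_eq_pd, hx p hp]; simp
  have hdv : ∀ p ∈ I ×ˢ J, dv x p = -spinorSq (z₁ p.2) (z₂ p.2) := fun p hp => by
    rw [dv_eq_pd, hx p hp]; simp
  have hduu : ∀ p ∈ I ×ˢ J, du (du x) p = (2 : ℝ) •
      spinorMul (y₁ p.1) (y₂ p.1) (deriv y₁ p.1) (deriv y₂ p.1) := fun p hp => by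
    rw [du_eq_pd (du x), pd_congr _ hU hp hdu, pd_comp_fst (hS _ hp.1), one_smul]
  have hduv : ∀ p ∈ I ×ˢ J, dv (du x) p = 0 := fun p hp => by
    rw [dv_eq_pd (du x), pd_congr _ hU hp hdu, pd_comp_fst (hS _ hp.1), zero_smul]
  have hdvv : ∀ p ∈ I ×ˢ J, dv (dv x) p = -((2 : ℝ) •
      spinorMul (z₁ p.2) (z₂ p.2) (deriv z₁ p.2) (deriv z₂ p.2)) := fun p hp => by
    rw [dv_eq_pd (dv x), pd_congr _ hU hp hdv, pd_comp_snd (hT _ hp.2), one_smul]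
  have hneg : ∀ a b, mink a (-b) = -mink a b := fun a b => by simp [mink]; ring
  have hneg' : ∀ a b, mink (-a) b = -mink a b := fun a b => by simp [mink]; ring
  have hE : ∀ p ∈ I ×ˢ J, coefE x p = 0 := fun p hp => by
    rw [coefE, hdu p hp, mink_spinorSq]
  have hG : ∀ p ∈ I ×ˢ J, coefG x p = 0 := fun p hp => by
    rw [coefG, hdv p hp, hneg, hneg', mink_spinorSq, neg_zero, neg_zero]
  have hF : ∀ p ∈ I ×ˢ J, coefF x p = 2 * (y₁ p.1 * z₂ p.2 - y₂ p.1 * z₁ p.2) ^ 2 :=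
    fun p hp => by
      rw [coefF, hdu p hp, hdv p hp, hneg, mink_spinorSq_spinorSq]; ring
  have hFpos : ∀ p ∈ I ×ˢ J, 0 < coefF x p := fun p hp => by
    rw [hF p hp]; have := hyz p hp; positivity
  have hl : ∀ p ∈ I ×ˢ J, unitNormal x p = (coefF x p)⁻¹ • (-1 : ℝ) •
      cross (spinorSq (y₁ p.1) (y₂ p.1)) (spinorSq (z₁ p.2) (z₂ p.2)) := fun p hp => by
    rw [unitNormal, len_cross (hE p hp) (hFpos p hp), hdu p hp, hdv p hp, cross_neg_right, coefF,
      hdu p hp, hdv p hp]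
  have hL : ∀ p ∈ I ×ˢ J, coefL x p = ε := fun p hp => by
    have := hyz p hp
    rw [coefL, hl p hp, hduu p hp, mink_smul_left, mink_smul_right, mink_smul_right,
      mink_spinorMul_cross, hy _ hp.1, hF p hp]
    field_simp
  have hM : ∀ p ∈ I ×ˢ J, coefM x p = 0 := fun p hp => by
    rw [coefM, hduv p hp, mink_zero_left]
  have hN : ∀ p ∈ I ×ˢ J, coefN x p = 1 := fun p hp => by
    have := hyz p hp
    rw [coefN, hl p hp, hdvv p hp, hneg', mink_smul_left, mink_smul_right, mink_smul_right,
      mink_spinorMul_cross', hz _ hp.2, hF p hp]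
    field_simp
  have hH : ∀ p ∈ I ×ˢ J, meanH x p = 0 := fun p hp => by
    rw [meanH_of_isotropic (hE p hp) (hG p hp) (hFpos p hp).ne', hM p hp, zero_div]
  have hK : ∀ p ∈ I ×ˢ J, gaussK x p = -ε / coefF x p ^ 2 := fun p hp => by
    rw [gaussK_of_isotropic (hE p hp), hL p hp, hN p hp, hM p hp]; ring
  have hε0 : ε ≠ 0 := by rcases hε with rfl | rfl <;> norm_num
  refine ⟨x, ⟨isCoordDomain_prod hI hJ hIc hJc h₀, ⟨hU, sx, fun p hp => ?_⟩, fun p hp => ?_, hH,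
    fun p hp => ⟨hE p hp, hG p hp, hFpos p hp⟩, h₀, ε, 1, hε, Or.inl rfl,
    fun u hu => hL _ hu, fun v hv => hN _ hv⟩, fun p hp => by rw [hK p hp, hF p hp]⟩
  · rw [hE p hp, zero_mul, zero_sub, neg_lt_zero]
    exact pow_pos (hFpos p hp) 2
  · rw [hH p hp, hK p hp]
    have := (hFpos p hp).ne'
    simp [hε0, this]

/-! ### Existence of a surface with prescribed curvature -/

/-- A solution of the natural equation has locally a constant sign. -/
theorem exists_abs_eq_of_ne_zero {U : Set (ℝ × ℝ)} (hU : IsPreconnected U) {K : ℝ × ℝ → ℝ}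
    (hK : ContinuousOn K U) (h0 : ∀ p ∈ U, K p ≠ 0) :
    ∃ ε : ℝ, (ε = 1 ∨ ε = -1) ∧ ∀ p ∈ U, K p = -ε * |K p| := by
  rcases U.eq_empty_or_nonempty with rfl | ⟨q, hq⟩
  · exact ⟨1, by simp⟩
  have hsign : ∀ p ∈ U, 0 < K p * K q := by
    intro p hp
    by_contra hcon
    have hr := (hU.image K hK).ordConnected.uIcc_subset (mem_image_of_mem K hp)
      (mem_image_of_mem K hq)
    have hz : (0 : ℝ) ∈ uIcc (K p) (K q) := by
      rw [mem_uIcc]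
      rcases mul_nonpos_iff.1 (not_lt.1 hcon) with h | h
      · exact Or.inr ⟨h.2, h.1⟩
      · exact Or.inl h
    obtain ⟨r, hr, hr0⟩ := hr hz
    exact h0 r hr hr0
  rcases lt_or_gt_of_ne (h0 q hq) with h | h
  -- The sign convention anticipates K = -LN/F² with L = ε and N = 1.
  · refine ⟨1, Or.inl rfl, fun p hp => ?_⟩
    have hp' : K p < 0 := neg_of_mul_pos_left (hsign p hp) h.le
    rw [abs_of_neg hp']; ring
  · refine ⟨-1, Or.inr rfl, fun p hp => ?_⟩
    have hp' : 0 < K p := pos_of_mul_pos_left (hsign p hp) h.le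
    rw [abs_of_pos hp']; ring

theorem exists_canonicalMinimal {D : Set (ℝ × ℝ)} {K : ℝ × ℝ → ℝ} (hD : IsOpen D)
    (hK : SolvesNatural D K) {p₀ : ℝ × ℝ} (h₀ : p₀ ∈ D) :
    ∃ U ⊆ D, ∃ x : ℝ × ℝ → R31, IsCanonicalMinimal U p₀ x ∧ ∀ p ∈ U, gaussK x p = K p := by
  obtain ⟨r, hr, hball⟩ := Metric.isOpen_iff.1 hD p₀ h₀
  let I := Metric.ball p₀.1 r
  let J := Metric.ball p₀.2 r
  have hI : IsOpen I := Metric.isOpen_ball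
  have hJ : IsOpen J := Metric.isOpen_ball
  have hIc : Convex ℝ I := convex_ball _ _
  have hJc : Convex ℝ J := convex_ball _ _
  have hu₀ : p₀.1 ∈ I := Metric.mem_ball_self hr
  have hv₀ : p₀.2 ∈ J := Metric.mem_ball_self hr
  have hUD : I ×ˢ J ⊆ D := by rwa [ball_prod_same]
  have hU : IsOpen (I ×ˢ J) := hI.prod hJ
  have hKs := hK.smooth.mono hUD
  have hK0 : ∀ p ∈ I ×ˢ J, K p ≠ 0 := fun p hp => hK.ne_zero p (hUD hp)
  obtain ⟨ε, hε, hKε⟩ := exists_abs_eq_of_ne_zero (hIc.prod hJc).isPreconnected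
    hKs.continuousOn hK0
  have hε2 : ε ^ 2 = 1 := by rcases hε with rfl | rfl <;> norm_num
  let φ : ℝ × ℝ → ℝ := fun q => Real.log (Real.sqrt |K q|)
  have sφ : ContDiffOn ℝ ∞ φ (I ×ˢ J) := by
    -- The constant sign makes |K| equal to -εK, hence smooth.
    have h1 : ContDiffOn ℝ ∞ (fun q => |K q|) (I ×ˢ J) :=
      (contDiffOn_const.mul hKs).congr (f := fun q => -ε * K q) fun p hp => by
        conv_rhs => rw [hKε p hp]
        linear_combination -|K p| * hε2
    exact (h1.sqrt fun p hp => abs_ne_zero.2 (hK0 p hp)).log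
      fun p hp => (Real.sqrt_pos.2 (abs_pos.2 (hK0 p hp))).ne'
  have hexp : ∀ p ∈ I ×ˢ J, Real.exp (φ p) = Real.sqrt |K p| := fun p hp =>
    Real.exp_log (Real.sqrt_pos.2 (abs_pos.2 (hK0 p hp)))
  -- Chosen so that 2τ² = 1/√|K|, the future F. The natural equation for φ then turns into the
  -- Liouville equation for τ.
  let τ : ℝ × ℝ → ℝ := fun q => Real.exp (-(φ q + Real.log 2) / 2)
  have sτ : ContDiffOn ℝ ∞ τ (I ×ˢ J) :=
    ((sφ.add contDiffOn_const).neg.div_const 2).exp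
  have hτ : ∀ p, 2 * τ p ^ 2 * Real.exp (φ p) = 1 := by
    intro p
    have h2 : τ p ^ 2 = Real.exp (-(φ p + Real.log 2)) := by
      rw [← Real.exp_nat_mul]; congr 1; push_cast; ring
    rw [h2, Real.exp_neg, Real.exp_add, Real.exp_log two_pos]
    have := (Real.exp_pos (φ p)).ne'
    field_simp
  have hdτ : ∀ e, ∀ p ∈ I ×ˢ J, pd e τ p = -(1 / 2) * pd e φ p * τ p := by
    intro e p hp
    have hd : HasDerivAt (fun t => Real.exp (-(t + Real.log 2) / 2))
        (τ p * (-1 / 2)) (φ p) :=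
      (((hasDerivAt_id (φ p)).add_const (Real.log 2)).neg.div_const 2).exp
    rw [pd_real_comp e hd (sφ.differentiableAt_of_isOpen hU hp)]
    ring
  have heq : ∀ p ∈ I ×ˢ J,
      τ p * pd (0, 1) (pd (1, 0) τ) p - pd (1, 0) τ p * pd (0, 1) τ p = ε / 4 := by
    intro p hp
    have hdφ := (contDiffOn_pd (1, 0) hU sφ).differentiableAt_of_isOpen hU hp
    have hd := pd_mul (0, 1) ((differentiableAt_const (-(1 / 2) : ℝ)).fun_mul hdφ)
      (sτ.differentiableAt_of_isOpen hU hp)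
    rw [pd_mul (0, 1) (differentiableAt_const (-(1 / 2) : ℝ)) hdφ, pd_const] at hd
    have hnat : Real.sqrt |K p| * pd (0, 1) (pd (1, 0) φ) p = K p := hK.eqn p (hUD hp)
    have hsq : Real.sqrt |K p| ^ 2 = |K p| := Real.sq_sqrt (abs_nonneg _)
    have h1 := hτ p
    rw [pd_congr (0, 1) hU hp (hdτ (1, 0)), hd, hdτ _ p hp, hdτ _ p hp]
    rw [hexp p hp] at h1
    have hs : Real.sqrt |K p| ≠ 0 := (Real.sqrt_pos.2 (abs_pos.2 (hK0 p hp))).ne'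
    have h2 : pd (0, 1) (pd (1, 0) φ) p = -ε * Real.sqrt |K p| := by
      apply mul_left_cancel₀ hs
      rw [hnat, hKε p hp, abs_mul, abs_abs, abs_neg,
        show |ε| = 1 by rcases hε with rfl | rfl <;> simp, one_mul]
      linear_combination ε * hsq
    rw [h2]
    linear_combination (ε / 4) * h1
  obtain ⟨y₁, y₂, z₁, z₂, hy₁, hy₂, hz₁, hz₂, hy, hz, hyz⟩ :=
    exists_separation hI hJ hIc hJc hu₀ hv₀ sτ (fun p _ => Real.exp_pos _) hε2 heq
  have hyz' : ∀ p ∈ I ×ˢ J, y₁ p.1 * z₂ p.2 - y₂ p.1 * z₁ p.2 = τ p := fun p hp =>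
    hyz _ hp.1 _ hp.2
  obtain ⟨x, hx, hxK⟩ := exists_canonicalMinimal_of_spinors hI hJ hIc hJc ⟨hu₀, hv₀⟩ hε hy₁ hy₂
    hz₁ hz₂ hy hz fun p hp => by rw [hyz' p hp]; exact (Real.exp_pos _).ne'
  refine ⟨I ×ˢ J, hUD, x, hx, fun p hp => ?_⟩
  have h1 := hτ p
  have h2 : Real.sqrt |K p| ^ 2 = |K p| := Real.sq_sqrt (abs_nonneg _)
  rw [hexp p hp] at h1
  have hτ0 : τ p ≠ 0 := (Real.exp_pos _).ne'
  rw [hxK p hp, hyz' p hp, hKε p hp, ← h2, eq_comm, eq_div_iff (by positivity)]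
  linear_combination -ε * (2 * τ p ^ 2 * Real.sqrt |K p| + 1) * h1

end LorentzSurf

end

theorem mainTheorem3 :
    (∀ (D : Set (ℝ × ℝ)) (p₀ : ℝ × ℝ) (x : ℝ × ℝ → LorentzSurf.R31),
      LorentzSurf.IsCanonicalMinimal D p₀ x →
        LorentzSurf.SolvesNatural D (LorentzSurf.gaussK x) ∧
        ∀ g : LorentzSurf.R31 → LorentzSurf.R31, LorentzSurf.IsMotion g →
          LorentzSurf.IsCanonicalMinimal D p₀ (fun p => g (x p)) ∧
          ∀ p ∈ D, LorentzSurf.gaussK (fun q => g (x q)) p = LorentzSurf.gaussK x p) ∧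
    (∀ (D : Set (ℝ × ℝ)) (K : ℝ × ℝ → ℝ), IsOpen D → LorentzSurf.SolvesNatural D K →
      (∀ p₀ ∈ D, ∃ U ⊆ D, ∃ x : ℝ × ℝ → LorentzSurf.R31,
        LorentzSurf.IsCanonicalMinimal U p₀ x ∧ ∀ p ∈ U, LorentzSurf.gaussK x p = K p) ∧
      (∀ U ⊆ D, ∀ (p₁ p₂ : ℝ × ℝ) (x₁ x₂ : ℝ × ℝ → LorentzSurf.R31),
        LorentzSurf.IsCanonicalMinimal U p₁ x₁ → (∀ p ∈ U, LorentzSurf.gaussK x₁ p = K p) →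
        LorentzSurf.IsCanonicalMinimal U p₂ x₂ → (∀ p ∈ U, LorentzSurf.gaussK x₂ p = K p) →
        ∃ g : LorentzSurf.R31 → LorentzSurf.R31, LorentzSurf.IsMotion g ∧
          ∀ p ∈ U, x₂ p = g (x₁ p))) := by
  refine ⟨fun D p₀ x h => ⟨h.solvesNatural, ?_⟩, fun D K hD hK =>
    ⟨fun p₀ h₀ => LorentzSurf.exists_canonicalMinimal hD hK h₀, ?_⟩⟩
  · rintro g ⟨A, b, hA, hg⟩
    exact ⟨h.motion hA hg, fun p hp => LorentzSurf.gaussK_motion hA hg h.isOpen h.smooth hp⟩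
  · intro U _ p₁ p₂ x₁ x₂ h₁ hK₁ h₂ hK₂
    exact LorentzSurf.exists_motion h₁ h₂ fun q hq => by rw [hK₁ q hq, hK₂ q hq]
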